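/- Let $[a,b]\subset\mathbb R$ be a finite interval, $a<b$, let $m,n,r\in\mathbb N$ and $\varepsilon_0>0$. For $k\ge 1$ let $W_\infty^k$ be the space of $y\in C^{k-1}[a,b]$ such that $y^{(k-1)}$ is absolutely continuous and $y^{(k)}\in L_\infty[a,b]$, with norm $\|y\|_{k,\infty}=\sum_{i=0}^{k}\|y^{(i)}\|_\infty$, and let $W_\infty^0=L_\infty[a,b]$; $(W_\infty^k)^m$ and $(W_\infty^k)^{m\times m}$ are the corresponding spaces of $\mathbb C^m$- and $\mathbb C^{m\times m}$-valued functions. For $\varepsilon\in[0,\varepsilon_0)$ consider the boundary-value problem $$y'(t)+A(t;\varepsilon)y(t)=f(t;\varepsilon)\ \text{ for almost all } t\in(a,b),\qquad B(\varepsilon)y=q(\varepsilon),\tag{P}$$ for an unknown function $y=y(\cdot;\varepsilon)\in(W_\infty^n)^m$, where $A(\cdot;\varepsilon)\in(W_\infty^{n-1})^{m\times m}$, $f(\cdot;\varepsilon)\in(W_\infty^{n-1})^m$, $q(\varepsilon)\in\mathbb C^m$ and $$B(\varepsilon)y=\sum_{j=0}^{r}\sum_{k=1}^{\omega_j(\varepsilon)}\sum_{l=0}^{n-1}\beta_{j,k}^{(l)}(\varepsilon)\,y^{(l)}(t_{j,k}(\varepsilon)),$$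 with $\omega_j(\varepsilon)\in\mathbb N$, $\beta_{j,k}^{(l)}(\varepsilon)\in\mathbb C^{m\times m}$ and $t_{j,k}(\varepsilon)\in[a,b]$. Let $t_j\in[a,b]$ and $\beta_j^{(l)}\in\mathbb C^{m\times m}$ ($1\le j\le r$, $0\le l\le n-1$), and suppose that at $\varepsilon=0$ the boundary operator is the limiting one: $B(0)y=\sum_{j=1}^{r}\sum_{l=0}^{n-1}\beta_j^{(l)}y^{(l)}(t_j)$ for all $y\in(W_\infty^n)^m$. Assume that, as $\varepsilon\to0+$, $(\alpha)$ $t_{j,k}(\varepsilon)\to t_j$ for all $j\in\{1,\dots,r\}$ and each $k\ge1$ (along those $\varepsilon$ with $k\le\omega_j(\varepsilon)$); $(\beta)$ $\sum_{k=1}^{\omega_j(\varepsilon)}\beta_{j,k}^{(l)}(\varepsilon)\to\beta_j^{(l)}$ for all $j\in\{1,\dots,r\}$, $l\in\{0,\dots,n-1\}$; $(\gamma)$ $\sum_{k=1}^{\omega_j(\varepsilon)}\|\beta_{j,k}^{(l)}(\varepsilon)\|\,|t_{j,k}(\varepsilon)-t_j|\to0$ for all $j\in\{1,\dots,r\}$,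 $l\in\{0,\dots,n-1\}$; $(\delta)$ $\sum_{k=1}^{\omega_0(\varepsilon)}\|\beta_{0,k}^{(l)}(\varepsilon)\|\to0$ for all $l\in\{0,\dots,n-1\}$. Then (II) $B(\varepsilon)y\to B(0)y$ in $\mathbb C^m$ as $\varepsilon\to0+$, for every $y\in(W_\infty^n)^m$. If, moreover, (0) the problem (P) with $\varepsilon=0$ and zero right-hand sides has only the trivial solution, and (I) $A(\cdot;\varepsilon)\to A(\cdot;0)$ in $(W_\infty^{n-1})^{m\times m}$ as $\varepsilon\to0+$, then there is $\varepsilon_1\in(0,\varepsilon_0)$ such that for every $\varepsilon\in[0,\varepsilon_1)$ and arbitrary $f(\cdot;\varepsilon)\in(W_\infty^{n-1})^m$, $q(\varepsilon)\in\mathbb C^m$ the problem (P) has a unique solution $y(\cdot;\varepsilon)\in(W_\infty^n)^m$; and whenever $f(\cdot;\varepsilon)\to f(\cdot;0)$ in $(W_\infty^{n-1})^m$ and $q(\varepsilon)\to q(0)$ in $\mathbb C^m$ as $\varepsilon\to0+$, these solutions satisfy $\|y(\cdot;\varepsilon)-y(\cdot;0)\|_{n,\infty}\to0$ as $\varepsilon\to0+$.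 -/

import Mathlib

open Filter Topology MeasureTheory
open scoped ENNReal Matrix

/- Matrices carry the operator norm for the maximum norm on `Fin m → ℂ`
(the choice of matrix norm is immaterial in finite dimension). -/
attribute [local instance] Matrix.linftyOpNormedAddCommGroup Matrix.linftyOpNormedSpace

namespace MultipointBVP

/-- The `k`-th derivative on the interval `[a,b]` (one-sided at the end points). -/
noncomputable def D {E : Type*} [NormedAddCommGroup E] [NormedSpace ℝ E]
    (a b : ℝ) (k : ℕ) (y : ℝ → E) : ℝ → E :=
  iteratedDerivWithin k y (Set.Icc a b)

/-- Membership in the Sobolev space `W_p^n([a,b]; E)`, with `W_p^0 = L_p`: for `n ≥ 1`,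
`y ∈ C^{n-1}[a,b]`, `y^{(n-1)}` is absolutely continuous on `[a,b]` and `y^{(n)} ∈ L_p[a,b]`.
Functions on `[a,b]` are represented by functions on `ℝ`; only the values on `[a,b]` matter. -/
def MemSobolev {E : Type*} [NormedAddCommGroup E] [NormedSpace ℝ E]
    (a b : ℝ) (n : ℕ) (p : ℝ≥0∞) (y : ℝ → E) : Prop :=
  match n with
  | 0 => MemLp y p (volume.restrict (Set.Icc a b))
  | k + 1 =>
      ContDiffOn ℝ k y (Set.Icc a b) ∧
      AbsolutelyContinuousOnInterval (D a b k y) a b ∧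
      MemLp (D a b (k + 1) y) p (volume.restrict (Set.Icc a b))

/-- The norm `‖y‖_{n,p} = ∑_{k=0}^{n} ‖y^{(k)}‖_p`, with values in `[0,∞]`. -/
noncomputable def sobolevNorm {E : Type*} [NormedAddCommGroup E] [NormedSpace ℝ E]
    (a b : ℝ) (n : ℕ) (p : ℝ≥0∞) (y : ℝ → E) : ℝ≥0∞ :=
  ∑ k ∈ Finset.range (n + 1), eLpNorm (D a b k y) p (volume.restrict (Set.Icc a b))

/-- `y ∈ (W_p^n)^m` solves `y' + A y = f` almost everywhere on `(a,b)` and `B y = q`.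
(For `n ≥ 2` and `A, f` in `W_p^{n-1}` both sides of the equation are continuous, so that it
then holds everywhere on `(a,b)`.) -/
def IsSolution {m : ℕ} (a b : ℝ) (n : ℕ) (p : ℝ≥0∞)
    (A : ℝ → Matrix (Fin m) (Fin m) ℂ) (B : (ℝ → Fin m → ℂ) → Fin m → ℂ)
    (f : ℝ → Fin m → ℂ) (q : Fin m → ℂ) (y : ℝ → Fin m → ℂ) : Prop :=
  MemSobolev a b n p y ∧
  (∀ᵐ t ∂(volume.restrict (Set.Ioo a b)), D a b 1 y t + A t *ᵥ y t = f t) ∧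
  B y = q

/-- The problem with homogeneous data has only the trivial solution. -/
def OnlyTrivialSolution {m : ℕ} (a b : ℝ) (n : ℕ) (p : ℝ≥0∞)
    (A : ℝ → Matrix (Fin m) (Fin m) ℂ) (B : (ℝ → Fin m → ℂ) → Fin m → ℂ) : Prop :=
  ∀ y : ℝ → Fin m → ℂ, IsSolution a b n p A B 0 0 y → Set.EqOn y 0 (Set.Icc a b)

/-- `g(·,ε) → g(·,0)` in `W_p^n([a,b]; E)` as `ε → 0+`. -/
def SobolevTendsto {E : Type*} [NormedAddCommGroup E] [NormedSpace ℝ E]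
    (a b : ℝ) (n : ℕ) (p : ℝ≥0∞) (g : ℝ → ℝ → E) : Prop :=
  Tendsto (fun ε => sobolevNorm a b n p (g ε - g 0)) (𝓝[>] 0) (𝓝 0)

/-- `B(ε) y → B(0) y` in `ℂ^m` as `ε → 0+`, for every `y ∈ (W_p^n)^m`. -/
def StrongTendsto {m : ℕ} (a b : ℝ) (n : ℕ) (p : ℝ≥0∞)
    (B : ℝ → (ℝ → Fin m → ℂ) → Fin m → ℂ) : Prop :=
  ∀ y : ℝ → Fin m → ℂ, MemSobolev a b n p y →
    Tendsto (fun ε => B ε y) (𝓝[>] 0) (𝓝 (B 0 y))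

/-- Continuous dependence of the solution on the parameter at `ε = 0`: for all small `ε ≥ 0`
and all right-hand sides there is exactly one solution (as a function on `[a,b]`), and
convergence of the right-hand sides implies convergence of the solutions in `(W_p^n)^m`. -/
def DependsContinuously {m : ℕ} (a b ε₀ : ℝ) (n : ℕ) (p : ℝ≥0∞)
    (A : ℝ → ℝ → Matrix (Fin m) (Fin m) ℂ)
    (B : ℝ → (ℝ → Fin m → ℂ) → Fin m → ℂ) : Prop :=
  ∃ ε₁ : ℝ, 0 < ε₁ ∧ ε₁ < ε₀ ∧
    (∀ ε ∈ Set.Ico 0 ε₁, ∀ f : ℝ → Fin m → ℂ, MemSobolev a b (n - 1) p f →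
      ∀ q : Fin m → ℂ, ∃ y, IsSolution a b n p (A ε) (B ε) f q y ∧
        ∀ z, IsSolution a b n p (A ε) (B ε) f q z → Set.EqOn z y (Set.Icc a b)) ∧
    (∀ (f : ℝ → ℝ → Fin m → ℂ) (q : ℝ → Fin m → ℂ),
      (∀ ε ∈ Set.Ico 0 ε₀, MemSobolev a b (n - 1) p (f ε)) →
      SobolevTendsto a b (n - 1) p f →
      Tendsto q (𝓝[>] 0) (𝓝 (q 0)) →
      ∀ y : ℝ → ℝ → Fin m → ℂ,
        (∀ ε ∈ Set.Ico 0 ε₁, IsSolution a b n p (A ε) (B ε) (f ε) (q ε) (y ε)) →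
        SobolevTendsto a b n p y)

/-- The multipoint operator
`B(ε) y = ∑_{j=0}^{r} ∑_{k=1}^{ω_j(ε)} ∑_{l=0}^{n-1} β_{j,k}^{(l)}(ε) y^{(l)}(t_{j,k}(ε))`;
here `t j k ε` is `t_{j,k}(ε)` and `β j k l ε` is `β_{j,k}^{(l)}(ε)`. -/
noncomputable def multipoint {m : ℕ} (a b : ℝ) (n r : ℕ) (ω : ℕ → ℝ → ℕ)
    (t : ℕ → ℕ → ℝ → ℝ) (β : ℕ → ℕ → ℕ → ℝ → Matrix (Fin m) (Fin m) ℂ)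
    (ε : ℝ) (y : ℝ → Fin m → ℂ) : Fin m → ℂ :=
  ∑ j ∈ Finset.range (r + 1), ∑ k ∈ Finset.Icc 1 (ω j ε), ∑ l ∈ Finset.range n,
    β j k l ε *ᵥ D a b l y (t j k ε)

/-- The limiting multipoint operator `∑_{j=1}^{r} ∑_{l=0}^{n-1} β_j^{(l)} y^{(l)}(t_j)`. -/
noncomputable def limitMultipoint {m : ℕ} (a b : ℝ) (n r : ℕ)
    (τ : ℕ → ℝ) (βlim : ℕ → ℕ → Matrix (Fin m) (Fin m) ℂ)
    (y : ℝ → Fin m → ℂ) : Fin m → ℂ :=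
  ∑ j ∈ Finset.Icc 1 r, ∑ l ∈ Finset.range n, βlim j l *ᵥ D a b l y (τ j)

end MultipointBVP

set_option linter.unusedSectionVars false

/-! For `p = ∞` the derivatives `y^{(l)}` with `l < n` are Lipschitz with constant at most
`‖y‖_{n,∞}`. Moving a node from `t_{j,k}(ε)` to `t_j` therefore costs at most `‖β‖ |t_{j,k}(ε) -
t_j| ‖y‖_{n,∞}`, and (β), (γ), (δ) give `‖B(ε)y - B(0)y‖ ≤ η(ε) ‖y‖_{n,∞}` with `η(ε) → 0`
independent of `y` (`norm_multipoint_sub_limitMultipoint_le`, `tendsto_modulus`). So the boundary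
operators converge in operator norm, which is more than (II).

The rest is perturbation theory. Gronwall's inequality and a bootstrap bound `y` in `W^{n+1}` by `y'
+ Ay` in `W^n` and the initial value (`exists_wnorm_le`). The map sending an initial value to the
boundary value of the homogeneous solution is linear on a finite-dimensional space. Condition (0)
makes it injective, so it is bounded below and the initial value can be traded for `B y`
(`exists_wnorm_le_boundary`). Since `A(ε)` and `B(ε)` are close to `A(0)` and `B(0)` in operator
norm, the estimate survives for small `ε` with a doubled constant (`exists_uniform_wnorm_le`). It
yields uniqueness, hence existence by the Fredholm alternative (`exists_boundaryValue_solution`),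
and applied to `y(ε) - y(0)` it yields convergence (`tendsto_wnorm_sub`). -/

namespace MultipointBVP

/-! ### The spaces `W_∞^n`: recursive description, norms, representatives. -/

section Basic

variable {E F : Type*} [NormedAddCommGroup E] [NormedSpace ℝ E]
  [NormedAddCommGroup F] [NormedSpace ℝ F]
variable {a b : ℝ} {n : ℕ}

/-- The Sobolev norm `‖y‖_{n,∞}` as a real number. -/
noncomputable def wnorm (a b : ℝ) (n : ℕ) (y : ℝ → E) : ℝ :=
  (sobolevNorm a b n ∞ y).toReal

theorem wnorm_nonneg (y : ℝ → E) : 0 ≤ wnorm a b n y := ENNReal.toReal_nonneg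

theorem D_zero (y : ℝ → E) : D a b 0 y = y := iteratedDerivWithin_zero

theorem D_one (y : ℝ → E) : D a b 1 y = derivWithin y (Set.Icc a b) := iteratedDerivWithin_one

theorem D_succ (k : ℕ) (y : ℝ → E) : D a b (k + 1) y = D a b k (derivWithin y (Set.Icc a b)) :=
  iteratedDerivWithin_succ'

theorem sobolevNorm_zero (y : ℝ → E) :
    sobolevNorm a b 0 ∞ y = eLpNorm y ∞ (volume.restrict (Set.Icc a b)) := by
  simp [sobolevNorm, D_zero]

theorem sobolevNorm_succ (y : ℝ → E) :
    sobolevNorm a b (n + 1) ∞ y =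
      sobolevNorm a b 0 ∞ y + sobolevNorm a b n ∞ (derivWithin y (Set.Icc a b)) := by
  unfold sobolevNorm
  rw [Finset.sum_range_succ' _ (n + 1), add_comm]
  simp [D_succ]

theorem lipschitzOnWith_congr {X : Type*} [NormedAddCommGroup X] {K : NNReal} {y z : ℝ → X}
    {s : Set ℝ} (hy : LipschitzOnWith K y s)
    (h : Set.EqOn y z s) : LipschitzOnWith K z s := fun t ht u hu => by
  rw [← h ht, ← h hu]; exact hy ht hu

theorem memLp_of_continuousOn {X : Type*} [NormedAddCommGroup X] {y : ℝ → X}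
    (hy : ContinuousOn y (Set.Icc a b)) :
    MemLp y ∞ (volume.restrict (Set.Icc a b)) := by
  obtain ⟨C, hC⟩ := isCompact_Icc.exists_bound_of_continuousOn hy
  refine memLp_top_of_bound (hy.aestronglyMeasurable measurableSet_Icc) C ?_
  filter_upwards [ae_restrict_mem measurableSet_Icc] with t ht using hC t ht

theorem intervalIntegrable_of_memLp {X : Type*} [NormedAddCommGroup X] {y : ℝ → X}
    (hy : MemLp y ∞ (volume.restrict (Set.Icc a b))) {s t : ℝ} (hs : s ∈ Set.Icc a b)
    (ht : t ∈ Set.Icc a b) : IntervalIntegrable y volume s t := by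
  have h : IntegrableOn y (Set.Icc a b) := hy.integrable le_top
  exact (h.mono_set (Set.uIcc_subset_Icc hs ht)).intervalIntegrable

theorem ae_norm_le_of_memLp {y : ℝ → E} (hy : MemLp y ∞ (volume.restrict (Set.Icc a b))) :
    ∀ᵐ t ∂(volume.restrict (Set.Icc a b)), ‖y t‖ ≤ wnorm a b 0 y := by
  have h := enorm_ae_le_eLpNormEssSup y (volume.restrict (Set.Icc a b))
  filter_upwards [h] with t ht
  rw [wnorm, sobolevNorm_zero, ← toReal_enorm]
  exact ENNReal.toReal_mono hy.2.ne (by simpa using ht)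

theorem wnorm_zero_le {y : ℝ → E} {C : ℝ} (hC : 0 ≤ C)
    (h : ∀ᵐ t ∂(volume.restrict (Set.Icc a b)), ‖y t‖ ≤ C) : wnorm a b 0 y ≤ C := by
  rw [wnorm, sobolevNorm_zero, eLpNorm_exponent_top]
  exact ENNReal.toReal_le_of_le_ofReal hC (eLpNormEssSup_le_of_ae_bound h)

theorem norm_le_of_ae_norm_le {X : Type*} [NormedAddCommGroup X] (hab : a < b) {y : ℝ → X} (hy : ContinuousOn y (Set.Icc a b))
    {C : ℝ} (h : ∀ᵐ t ∂(volume.restrict (Set.Icc a b)), ‖y t‖ ≤ C) {t : ℝ}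
    (ht : t ∈ Set.Icc a b) : ‖y t‖ ≤ C := by
  -- Phrased as an equality of continuous functions, `max ‖y‖ C = C`, the bound passes from almost
  -- everywhere to everywhere.
  have := Measure.eqOn_Icc_of_ae_eq volume hab.ne (f := fun t => max ‖y t‖ C) (g := fun _ => C)
    (by filter_upwards [h] with t ht using max_eq_right ht)
    (hy.norm.sup continuousOn_const) continuousOn_const ht
  simpa using this

theorem norm_le_wnorm_zero (hab : a < b) {y : ℝ → E} (hy : ContinuousOn y (Set.Icc a b)) {t : ℝ}
    (ht : t ∈ Set.Icc a b) : ‖y t‖ ≤ wnorm a b 0 y :=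
  norm_le_of_ae_norm_le hab hy (ae_norm_le_of_memLp (memLp_of_continuousOn hy)) ht

/-- A bounded measurable function has a Lipschitz primitive. -/
theorem norm_integral_sub_le {y : ℝ → E}
    (hy : MemLp y ∞ (volume.restrict (Set.Icc a b))) {C : ℝ}
    (h : ∀ᵐ t ∂(volume.restrict (Set.Icc a b)), ‖y t‖ ≤ C) {s t : ℝ} (hs : s ∈ Set.Icc a b)
    (ht : t ∈ Set.Icc a b) :
    ‖(∫ u in a..t, y u) - ∫ u in a..s, y u‖ ≤ C * |t - s| := by
  have ha : a ∈ Set.Icc a b := ⟨le_rfl, hs.1.trans hs.2⟩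
  rw [intervalIntegral.integral_interval_sub_left (intervalIntegrable_of_memLp hy ha ht)
    (intervalIntegrable_of_memLp hy ha hs)]
  refine intervalIntegral.norm_integral_le_of_norm_le_const_ae ?_
  rw [ae_restrict_iff' measurableSet_Icc] at h
  filter_upwards [h] with u hu hu'
  exact hu (Set.uIcc_subset_Icc hs ht (Set.uIoc_subset_uIcc hu'))

theorem exists_lipschitzOnWith_integral {y : ℝ → E}
    (hy : MemLp y ∞ (volume.restrict (Set.Icc a b))) (c : E) :
    ∃ K, LipschitzOnWith K (fun t => c + ∫ u in a..t, y u) (Set.Icc a b) := by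
  refine ⟨(wnorm a b 0 y).toNNReal, LipschitzOnWith.of_dist_le_mul fun t ht s hs => ?_⟩
  rw [dist_add_left, dist_eq_norm, Real.dist_eq, Real.coe_toNNReal _ (wnorm_nonneg y)]
  exact norm_integral_sub_le hy (ae_norm_le_of_memLp hy) hs ht

theorem ae_mem_Ioo : ∀ᵐ t ∂(volume.restrict (Set.Icc a b)), t ∈ Set.Ioo a b := by
  rw [← restrict_Ioo_eq_restrict_Icc]
  exact ae_restrict_mem measurableSet_Ioo

theorem ae_hasDerivAt_integral [CompleteSpace E] (hab : a ≤ b) {y : ℝ → E}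
    (hy : MemLp y ∞ (volume.restrict (Set.Icc a b))) :
    ∀ᵐ t ∂(volume.restrict (Set.Icc a b)), HasDerivAt (fun t => ∫ u in a..t, y u) (y t) t := by
  have h := (intervalIntegrable_of_memLp hy (Set.left_mem_Icc.2 hab)
    (Set.right_mem_Icc.2 hab)).ae_hasDerivAt_integral
  rw [ae_restrict_iff' measurableSet_Icc]
  filter_upwards [h] with t ht hmem
  rw [Set.uIcc_of_le hab] at ht
  exact ht hmem a (Set.left_mem_Icc.2 hab)

/-- The derivative of an arbitrary function is measurable, and it agrees with the one-sided version
off the two end points. -/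
theorem aestronglyMeasurable_derivWithin [FiniteDimensional ℝ E] (y : ℝ → E) :
    AEStronglyMeasurable (derivWithin y (Set.Icc a b)) (volume.restrict (Set.Icc a b)) := by
  borelize E
  have : AEStronglyMeasurable (deriv y) (volume.restrict (Set.Icc a b)) := by
    have := FiniteDimensional.complete ℝ E
    exact (measurable_deriv y).aestronglyMeasurable
  refine this.congr ?_
  filter_upwards [ae_mem_Ioo] with t ht
  rw [derivWithin_of_mem_nhds (Icc_mem_nhds ht.1 ht.2)]

theorem ae_differentiableAt_of_lipschitzOnWith [FiniteDimensional ℝ E] {y : ℝ → E} {K : NNReal}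
    (hy : LipschitzOnWith K y (Set.Icc a b)) :
    ∀ᵐ t ∂(volume.restrict (Set.Icc a b)), DifferentiableAt ℝ y t := by
  filter_upwards [hy.ae_differentiableWithinAt_real measurableSet_Icc, ae_mem_Ioo] with t h ht
  exact h.differentiableAt (Icc_mem_nhds ht.1 ht.2)

/-- The fundamental theorem of calculus for absolutely continuous functions with bounded
derivative. -/
theorem eq_add_integral_derivWithin [FiniteDimensional ℝ E] (hab : a < b) {y : ℝ → E}
    (hy : AbsolutelyContinuousOnInterval y a b)
    (hy' : MemLp (derivWithin y (Set.Icc a b)) ∞ (volume.restrict (Set.Icc a b))) {t : ℝ}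
    (ht : t ∈ Set.Icc a b) :
    y t = y a + ∫ u in a..t, derivWithin y (Set.Icc a b) u := by
  have := FiniteDimensional.complete ℝ E
  obtain ⟨K, hK⟩ := exists_lipschitzOnWith_integral hy' 0
  simp only [zero_add] at hK
  -- The difference of `y` and the integral is absolutely continuous with derivative zero almost
  -- everywhere, hence constant.
  have hac := hy.sub (show AbsolutelyContinuousOnInterval
    (fun t => ∫ u in a..t, derivWithin y (Set.Icc a b) u) a b from
      LipschitzOnWith.absolutelyContinuousOnInterval (K := K) (by rwa [Set.uIcc_of_le hab.le]))
  have hae : ∀ᵐ x, x ∈ Set.uIcc a b →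
      HasDerivAt (y - fun t => ∫ u in a..t, derivWithin y (Set.Icc a b) u) 0 x := by
    have h1 := hy.boundedVariationOn.ae_differentiableAt_of_mem_uIcc
    have h2 := ae_hasDerivAt_integral hab.le hy'
    have h3 := ae_mem_Ioo (a := a) (b := b)
    rw [ae_restrict_iff' measurableSet_Icc] at h2 h3
    filter_upwards [h1, h2, h3] with x hx1 hx2 hx3 hx
    have hx' : x ∈ Set.Icc a b := by rwa [Set.uIcc_of_le hab.le] at hx
    have h := hx2 hx'
    rw [derivWithin_of_mem_nhds (Icc_mem_nhds (hx3 hx').1 (hx3 hx').2)] at h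
    simpa using (hx1 hx).hasDerivAt.sub h
  obtain ⟨C, hC⟩ := hac.const_of_ae_hasDerivAt_zero hae
  rw [Set.uIcc_of_le hab.le] at hC
  have h1 := hC t ht
  have h2 := hC a (Set.left_mem_Icc.2 hab.le)
  simp only [Pi.sub_apply, intervalIntegral.integral_same, sub_zero] at h1 h2
  rw [h2, ← h1]; abel

theorem ae_norm_derivWithin_le_of_lipschitzOnWith {y : ℝ → E} {K : NNReal}
    (hy : LipschitzOnWith K y (Set.Icc a b)) :
    ∀ᵐ t ∂(volume.restrict (Set.Icc a b)), ‖derivWithin y (Set.Icc a b) t‖ ≤ K := by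
  filter_upwards [ae_mem_Ioo] with t ht
  have h := Icc_mem_nhds ht.1 ht.2
  rw [derivWithin_of_mem_nhds h]
  exact norm_deriv_le_of_lipschitzOn h hy

/-- A primitive of a bounded function is Lipschitz; conversely a Lipschitz constant bounds the
derivative at interior points. The Lipschitz form avoids handling absolute continuity later. -/
theorem memSobolev_one_iff [FiniteDimensional ℝ E] (hab : a < b) {y : ℝ → E} :
    MemSobolev a b 1 ∞ y ↔ ∃ K, LipschitzOnWith K y (Set.Icc a b) := by
  have := FiniteDimensional.complete ℝ E
  constructor
  · rintro ⟨-, h2, h3⟩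
    rw [D_zero] at h2
    rw [D_succ, D_zero] at h3
    obtain ⟨K, hK⟩ := exists_lipschitzOnWith_integral h3 (y a)
    exact ⟨K, lipschitzOnWith_congr hK fun t ht => (eq_add_integral_derivWithin hab h2 h3 ht).symm⟩
  · rintro ⟨K, hK⟩
    refine ⟨by simpa using hK.continuousOn, ?_, ?_⟩
    · rw [D_zero]
      rw [← Set.uIcc_of_le hab.le] at hK
      exact hK.absolutelyContinuousOnInterval
    · rw [D_succ, D_zero]
      exact memLp_top_of_bound (aestronglyMeasurable_derivWithin y) K
        (ae_norm_derivWithin_le_of_lipschitzOnWith hK)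

theorem memSobolev_add_two_iff (hab : a < b) {y : ℝ → E} :
    MemSobolev a b (n + 2) ∞ y ↔
      DifferentiableOn ℝ y (Set.Icc a b) ∧
        MemSobolev a b (n + 1) ∞ (derivWithin y (Set.Icc a b)) := by
  simp only [MemSobolev, D_succ]
  rw [Nat.cast_add, Nat.cast_one, contDiffOn_succ_iff_derivWithin (uniqueDiffOn_Icc hab)]
  simp [and_assoc]

theorem MemSobolev.continuousOn {y : ℝ → E} (hy : MemSobolev a b (n + 1) ∞ y) :
    ContinuousOn y (Set.Icc a b) := hy.1.continuousOn

theorem MemSobolev.memLp {y : ℝ → E} (hy : MemSobolev a b n ∞ y) :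
    MemLp y ∞ (volume.restrict (Set.Icc a b)) := by
  cases n with
  | zero => exact hy
  | succ n => exact memLp_of_continuousOn hy.continuousOn

/-- The recursion behind all later inductions on `n`. For `n ≥ 1` the Lipschitz clause is automatic
by compactness; for `n = 0` it stands in for differentiability, which then holds only almost
everywhere. -/
theorem memSobolev_succ_iff [FiniteDimensional ℝ E] (hab : a < b) {y : ℝ → E} :
    MemSobolev a b (n + 1) ∞ y ↔
      (∃ K, LipschitzOnWith K y (Set.Icc a b)) ∧
      (n ≠ 0 → DifferentiableOn ℝ y (Set.Icc a b)) ∧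
        MemSobolev a b n ∞ (derivWithin y (Set.Icc a b)) := by
  cases n with
  | zero =>
    refine ⟨fun h => ⟨(memSobolev_one_iff hab).1 h, by simp, ?_⟩, fun h =>
      (memSobolev_one_iff hab).2 h.1⟩
    have := h.2.2
    rwa [D_one] at this
  | succ n =>
    rw [memSobolev_add_two_iff hab]
    refine ⟨fun h => ⟨?_, fun _ => h.1, h.2⟩, fun h => ⟨h.2.1 n.succ_ne_zero, h.2.2⟩⟩
    obtain ⟨C, hC⟩ := isCompact_Icc.exists_bound_of_continuousOn h.2.continuousOn
    refine ⟨C.toNNReal, (convex_Icc a b).lipschitzOnWith_of_nnnorm_derivWithin_le h.1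
      fun t ht => ?_⟩
    rw [← NNReal.coe_le_coe, coe_nnnorm]
    exact (hC t ht).trans (Real.le_coe_toNNReal C)

theorem MemSobolev.derivWithin [FiniteDimensional ℝ E] (hab : a < b) {y : ℝ → E}
    (hy : MemSobolev a b (n + 1) ∞ y) : MemSobolev a b n ∞ (derivWithin y (Set.Icc a b)) :=
  ((memSobolev_succ_iff hab).1 hy).2.2

theorem MemSobolev.of_succ [FiniteDimensional ℝ E] (hab : a < b) {y : ℝ → E}
    (hy : MemSobolev a b (n + 1) ∞ y) : MemSobolev a b n ∞ y := by
  induction n generalizing y with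
  | zero => exact hy.memLp
  | succ n ih =>
    obtain ⟨h1, h2, h3⟩ := (memSobolev_succ_iff hab).1 hy
    exact (memSobolev_succ_iff hab).2 ⟨h1, fun _ => h2 n.succ_ne_zero, ih h3⟩

theorem MemSobolev.mono [FiniteDimensional ℝ E] (hab : a < b) {y : ℝ → E} {k : ℕ}
    (hy : MemSobolev a b n ∞ y) (hk : k ≤ n) : MemSobolev a b k ∞ y := by
  induction n, hk using Nat.le_induction with
  | base => exact hy
  | succ n _ ih => exact ih (hy.of_succ hab)

theorem MemSobolev.sobolevNorm_ne_top [FiniteDimensional ℝ E] (hab : a < b) {y : ℝ → E}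
    (hy : MemSobolev a b n ∞ y) : sobolevNorm a b n ∞ y ≠ ∞ := by
  induction n generalizing y with
  | zero => rw [sobolevNorm_zero]; exact hy.2.ne
  | succ n ih =>
    rw [sobolevNorm_succ, sobolevNorm_zero]
    exact ENNReal.add_ne_top.2 ⟨hy.memLp.2.ne, ih (hy.derivWithin hab)⟩

theorem wnorm_succ [FiniteDimensional ℝ E] (hab : a < b) {y : ℝ → E}
    (hy : MemSobolev a b (n + 1) ∞ y) :
    wnorm a b (n + 1) y = wnorm a b 0 y + wnorm a b n (derivWithin y (Set.Icc a b)) := by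
  rw [wnorm, sobolevNorm_succ, ENNReal.toReal_add]
  · rfl
  · exact (hy.mono hab (Nat.zero_le _)).sobolevNorm_ne_top hab
  · exact (hy.derivWithin hab).sobolevNorm_ne_top hab

theorem wnorm_mono [FiniteDimensional ℝ E] (hab : a < b) {y : ℝ → E} {k : ℕ}
    (hy : MemSobolev a b n ∞ y) (hk : k ≤ n) : wnorm a b k y ≤ wnorm a b n y := by
  refine ENNReal.toReal_mono (hy.sobolevNorm_ne_top hab) ?_
  exact Finset.sum_le_sum_of_subset (Finset.range_subset_range.2 (by omega))

theorem MemSobolev.D [FiniteDimensional ℝ E] (hab : a < b) {y : ℝ → E} {k : ℕ}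
    (hy : MemSobolev a b (k + n) ∞ y) : MemSobolev a b n ∞ (D a b k y) := by
  induction k generalizing y with
  | zero => simpa [D_zero] using hy
  | succ k ih =>
    rw [D_succ]
    refine ih (MemSobolev.derivWithin hab ?_)
    convert hy using 1
    omega

theorem wnorm_D_le [FiniteDimensional ℝ E] (hab : a < b) {y : ℝ → E} {k : ℕ}
    (hy : MemSobolev a b (k + n) ∞ y) : wnorm a b n (D a b k y) ≤ wnorm a b (k + n) y := by
  induction k generalizing y with
  | zero => simp [D_zero]
  | succ k ih =>
    have hy' : MemSobolev a b (k + n + 1) ∞ y := by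
      convert hy using 1
      omega
    rw [D_succ, show k + 1 + n = k + n + 1 by omega, wnorm_succ hab hy']
    linarith [ih (hy'.derivWithin hab), wnorm_nonneg (a := a) (b := b) (n := 0) y]

theorem MemSobolev.eq_add_integral [FiniteDimensional ℝ E] (hab : a < b) {y : ℝ → E}
    (hy : MemSobolev a b (n + 1) ∞ y) {t : ℝ} (ht : t ∈ Set.Icc a b) :
    y t = y a + ∫ u in a..t, _root_.derivWithin y (Set.Icc a b) u := by
  have h := hy.mono hab (show 1 ≤ n + 1 by omega)
  have h2 := h.2.1
  rw [D_zero] at h2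
  exact eq_add_integral_derivWithin hab h2 (h.derivWithin hab).memLp ht

theorem MemSobolev.norm_sub_le [FiniteDimensional ℝ E] (hab : a < b) {y : ℝ → E}
    (hy : MemSobolev a b 1 ∞ y) {s t : ℝ} (hs : s ∈ Set.Icc a b) (ht : t ∈ Set.Icc a b) :
    ‖y t - y s‖ ≤ wnorm a b 1 y * |t - s| := by
  have h := hy.derivWithin hab
  rw [hy.eq_add_integral hab hs, hy.eq_add_integral hab ht, add_sub_add_left_eq_sub]
  refine (norm_integral_sub_le h (ae_norm_le_of_memLp h) hs ht).trans ?_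
  gcongr
  rw [wnorm_succ hab hy]
  linarith [wnorm_nonneg (a := a) (b := b) (n := 0) y]

theorem norm_D_le_wnorm [FiniteDimensional ℝ E] (hab : a < b) {y : ℝ → E}
    (hy : MemSobolev a b n ∞ y) {l : ℕ} (hl : l < n) {t : ℝ} (ht : t ∈ Set.Icc a b) :
    ‖D a b l y t‖ ≤ wnorm a b n y := by
  have h1 : MemSobolev a b (l + 1) ∞ y := hy.mono hab hl
  calc ‖D a b l y t‖ ≤ wnorm a b 0 (D a b l y) :=
        norm_le_wnorm_zero hab (h1.D hab).continuousOn ht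
    _ ≤ wnorm a b (l + 0) y := wnorm_D_le hab (hy.mono hab hl.le)
    _ ≤ wnorm a b n y := wnorm_mono hab hy hl.le

/-- Since `l + 1 ≤ n`, `y^{(l)}` lies in `W_∞^1` and is Lipschitz. The linear rate in `|t - s|` is
what pairs with the sums in (γ). -/
theorem norm_D_sub_le_wnorm [FiniteDimensional ℝ E] (hab : a < b) {y : ℝ → E}
    (hy : MemSobolev a b n ∞ y) {l : ℕ} (hl : l < n) {s t : ℝ} (hs : s ∈ Set.Icc a b)
    (ht : t ∈ Set.Icc a b) : ‖D a b l y t - D a b l y s‖ ≤ wnorm a b n y * |t - s| := by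
  have h1 : MemSobolev a b (l + 1) ∞ y := hy.mono hab hl
  refine ((h1.D hab).norm_sub_le hab hs ht).trans ?_
  gcongr
  exact (wnorm_D_le hab h1).trans (wnorm_mono hab hy hl)

/-- Equality of representatives: almost everywhere in `W^0`, everywhere in `W^n` for `n ≥ 1`. -/
def SameOn {X : Type*} (a b : ℝ) (n : ℕ) (g h : ℝ → X) : Prop :=
  g =ᵐ[volume.restrict (Set.Icc a b)] h ∧ (n ≠ 0 → Set.EqOn g h (Set.Icc a b))

theorem sameOn_of_eqOn {X : Type*} {g h : ℝ → X} (H : Set.EqOn g h (Set.Icc a b)) : SameOn a b n g h :=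
  ⟨by filter_upwards [ae_restrict_mem measurableSet_Icc] with t ht using H ht, fun _ => H⟩

theorem sameOn_of_ae (hab : a < b) {g h : ℝ → E} (hg : MemSobolev a b n ∞ g)
    (hh : MemSobolev a b n ∞ h) (H : g =ᵐ[volume.restrict (Set.Icc a b)] h) :
    SameOn a b n g h := by
  refine ⟨H, fun hn => ?_⟩
  obtain ⟨k, rfl⟩ := Nat.exists_eq_succ_of_ne_zero hn
  exact Measure.eqOn_Icc_of_ae_eq volume hab.ne H hg.continuousOn hh.continuousOn

theorem SameOn.wnorm_eq {g h : ℝ → E} (H : SameOn a b n g h) : wnorm a b n g = wnorm a b n h := by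
  unfold wnorm
  congr 1
  cases n with
  | zero => rw [sobolevNorm_zero, sobolevNorm_zero, eLpNorm_congr_ae H.1]
  | succ n =>
    refine Finset.sum_congr rfl fun k _ => eLpNorm_congr_ae ?_
    filter_upwards [ae_restrict_mem measurableSet_Icc] with t ht
    exact iteratedDerivWithin_congr (H.2 n.succ_ne_zero) ht

theorem D_eqOn {g h : ℝ → E} (H : Set.EqOn g h (Set.Icc a b)) (k : ℕ) :
    Set.EqOn (D a b k g) (D a b k h) (Set.Icc a b) := iteratedDerivWithin_congr H

theorem memSobolev_congr_of_eqOn [FiniteDimensional ℝ E] (hab : a < b) {g h : ℝ → E}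
    (H : Set.EqOn g h (Set.Icc a b)) (hg : MemSobolev a b n ∞ g) : MemSobolev a b n ∞ h := by
  induction n generalizing g h with
  | zero => exact (memLp_congr_ae (sameOn_of_eqOn (n := 0) H).1).1 hg
  | succ n ih =>
    obtain ⟨⟨K, h1⟩, h2, h3⟩ := (memSobolev_succ_iff hab).1 hg
    exact (memSobolev_succ_iff hab).2 ⟨⟨K, lipschitzOnWith_congr h1 H⟩,
      fun hn => (h2 hn).congr H.symm, ih (fun t ht => derivWithin_congr H (H ht)) h3⟩

theorem MemSobolev.congr [FiniteDimensional ℝ E] (hab : a < b) {g h : ℝ → E}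
    (hg : MemSobolev a b n ∞ g) (H : SameOn a b n g h) : MemSobolev a b n ∞ h := by
  cases n with
  | zero => exact (memLp_congr_ae H.1).1 hg
  | succ n => exact memSobolev_congr_of_eqOn hab (H.2 n.succ_ne_zero) hg

/-- Transfers pointwise differentiation rules to Sobolev functions: Lipschitz functions are
differentiable almost everywhere, and for `n ≥ 1` differentiability holds throughout `[a,b]`,
matching the two clauses of `SameOn`. -/
theorem sameOn_of_differentiable [FiniteDimensional ℝ E] [FiniteDimensional ℝ F] (hab : a < b)
    {y : ℝ → E} {z : ℝ → F} (hy : MemSobolev a b (n + 1) ∞ y) (hz : MemSobolev a b (n + 1) ∞ z)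
    {X : Type*} {g h : ℝ → X} (H : ∀ t ∈ Set.Icc a b, DifferentiableWithinAt ℝ y (Set.Icc a b) t →
      DifferentiableWithinAt ℝ z (Set.Icc a b) t → g t = h t) : SameOn a b n g h := by
  obtain ⟨⟨K, h1⟩, h2, -⟩ := (memSobolev_succ_iff hab).1 hy
  obtain ⟨⟨K', h1'⟩, h2', -⟩ := (memSobolev_succ_iff hab).1 hz
  refine ⟨?_, fun hn t ht => H t ht (h2 hn t ht) (h2' hn t ht)⟩
  filter_upwards [ae_differentiableAt_of_lipschitzOnWith h1,
    ae_differentiableAt_of_lipschitzOnWith h1', ae_restrict_mem measurableSet_Icc] with t h h' ht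
  exact H t ht h.differentiableWithinAt h'.differentiableWithinAt

end Basic

/-! ### Sums, products and primitives in `W_∞^n`; the operator `y' + Ay`. -/

section Algebra

variable {E F G : Type*} [NormedAddCommGroup E] [NormedSpace ℝ E] [FiniteDimensional ℝ E]
  [NormedAddCommGroup F] [NormedSpace ℝ F] [FiniteDimensional ℝ F]
  [NormedAddCommGroup G] [NormedSpace ℝ G] [FiniteDimensional ℝ G]
variable {a b : ℝ} {n : ℕ}

theorem sameOn_derivWithin_add (hab : a < b) {y z : ℝ → E} (hy : MemSobolev a b (n + 1) ∞ y)
    (hz : MemSobolev a b (n + 1) ∞ z) :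
    SameOn a b n (derivWithin y (Set.Icc a b) + derivWithin z (Set.Icc a b))
      (derivWithin (y + z) (Set.Icc a b)) :=
  sameOn_of_differentiable hab hy hz fun _ _ h h' => (derivWithin_add h h').symm

theorem MemSobolev.add (hab : a < b) {y z : ℝ → E} (hy : MemSobolev a b n ∞ y)
    (hz : MemSobolev a b n ∞ z) : MemSobolev a b n ∞ (y + z) := by
  induction n generalizing y z with
  | zero => exact MemLp.add hy hz
  | succ n ih =>
    have hs := sameOn_derivWithin_add hab hy hz
    obtain ⟨⟨K, h1⟩, h2, h3⟩ := (memSobolev_succ_iff hab).1 hy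
    obtain ⟨⟨K', h1'⟩, h2', h3'⟩ := (memSobolev_succ_iff hab).1 hz
    exact (memSobolev_succ_iff hab).2 ⟨⟨K + K', h1.add h1'⟩, fun hn => (h2 hn).add (h2' hn),
      (ih h3 h3').congr hab hs⟩

theorem wnorm_add_le (hab : a < b) {y z : ℝ → E} (hy : MemSobolev a b n ∞ y)
    (hz : MemSobolev a b n ∞ z) : wnorm a b n (y + z) ≤ wnorm a b n y + wnorm a b n z := by
  induction n generalizing y z with
  | zero =>
    refine wnorm_zero_le (add_nonneg (wnorm_nonneg _) (wnorm_nonneg _)) ?_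
    filter_upwards [ae_norm_le_of_memLp hy, ae_norm_le_of_memLp hz] with t h h'
    exact (norm_add_le _ _).trans (add_le_add h h')
  | succ n ih =>
    have hs := sameOn_derivWithin_add hab hy hz
    have h0 : wnorm a b 0 (y + z) ≤ wnorm a b 0 y + wnorm a b 0 z := by
      refine wnorm_zero_le (add_nonneg (wnorm_nonneg _) (wnorm_nonneg _)) ?_
      filter_upwards [ae_norm_le_of_memLp hy.memLp, ae_norm_le_of_memLp hz.memLp] with t h h'
      exact (norm_add_le _ _).trans (add_le_add h h')
    rw [wnorm_succ hab hy, wnorm_succ hab hz, wnorm_succ hab (hy.add hab hz), ← hs.wnorm_eq]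
    linarith [ih (hy.derivWithin hab) (hz.derivWithin hab)]

theorem sameOn_derivWithin_clm (hab : a < b) (T : E →L[ℝ] F) {y : ℝ → E}
    (hy : MemSobolev a b (n + 1) ∞ y) :
    SameOn a b n (fun t => T (derivWithin y (Set.Icc a b) t))
      (derivWithin (fun t => T (y t)) (Set.Icc a b)) :=
  sameOn_of_differentiable hab hy hy fun t ht h _ =>
    ((T.hasFDerivAt.comp_hasDerivWithinAt t h.hasDerivWithinAt).derivWithin
      (uniqueDiffOn_Icc hab t ht)).symm

theorem MemSobolev.clm (hab : a < b) (T : E →L[ℝ] F) {y : ℝ → E} (hy : MemSobolev a b n ∞ y) :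
    MemSobolev a b n ∞ (fun t => T (y t)) := by
  induction n generalizing y with
  | zero => exact T.comp_memLp' hy
  | succ n ih =>
    obtain ⟨⟨K, h1⟩, h2, h3⟩ := (memSobolev_succ_iff hab).1 hy
    exact (memSobolev_succ_iff hab).2 ⟨⟨_, T.lipschitz.comp_lipschitzOnWith h1⟩,
      fun hn => T.differentiable.comp_differentiableOn (h2 hn),
      (ih h3).congr hab (sameOn_derivWithin_clm hab T hy)⟩

theorem wnorm_clm_le (hab : a < b) (T : E →L[ℝ] F) {y : ℝ → E} (hy : MemSobolev a b n ∞ y) :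
    wnorm a b n (fun t => T (y t)) ≤ ‖T‖ * wnorm a b n y := by
  have h0 {k : ℕ} {y : ℝ → E} (hy : MemSobolev a b k ∞ y) :
      wnorm a b 0 (fun t => T (y t)) ≤ ‖T‖ * wnorm a b 0 y := by
    refine wnorm_zero_le (mul_nonneg (norm_nonneg _) (wnorm_nonneg _)) ?_
    filter_upwards [ae_norm_le_of_memLp hy.memLp] with t h
    exact T.le_opNorm_of_le h
  induction n generalizing y with
  | zero => exact h0 hy
  | succ n ih =>
    rw [wnorm_succ hab hy, wnorm_succ hab (hy.clm hab T),
      ← (sameOn_derivWithin_clm hab T hy).wnorm_eq, mul_add]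
    exact add_le_add (h0 hy) (ih (hy.derivWithin hab))

theorem MemSobolev.const_smul (hab : a < b) (c : ℝ) {y : ℝ → E} (hy : MemSobolev a b n ∞ y) :
    MemSobolev a b n ∞ (c • y) := hy.clm hab (c • ContinuousLinearMap.id ℝ E)

theorem MemSobolev.neg (hab : a < b) {y : ℝ → E} (hy : MemSobolev a b n ∞ y) :
    MemSobolev a b n ∞ (-y) := hy.clm hab (-ContinuousLinearMap.id ℝ E)

theorem wnorm_neg_le (hab : a < b) {y : ℝ → E} (hy : MemSobolev a b n ∞ y) :
    wnorm a b n (-y) ≤ wnorm a b n y := by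
  refine (wnorm_clm_le hab (-ContinuousLinearMap.id ℝ E) hy).trans ?_
  rw [norm_neg]
  exact mul_le_of_le_one_left (wnorm_nonneg _) ContinuousLinearMap.norm_id_le

theorem MemSobolev.sub (hab : a < b) {y z : ℝ → E} (hy : MemSobolev a b n ∞ y)
    (hz : MemSobolev a b n ∞ z) : MemSobolev a b n ∞ (y - z) := by
  rw [sub_eq_add_neg]; exact hy.add hab (hz.neg hab)

theorem wnorm_sub_le (hab : a < b) {y z : ℝ → E} (hy : MemSobolev a b n ∞ y)
    (hz : MemSobolev a b n ∞ z) : wnorm a b n (y - z) ≤ wnorm a b n y + wnorm a b n z := by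
  rw [sub_eq_add_neg]
  exact (wnorm_add_le hab hy (hz.neg hab)).trans (by gcongr; exact wnorm_neg_le hab hz)

theorem memSobolev_zero_fun (hab : a < b) : MemSobolev a b n ∞ (0 : ℝ → E) := by
  induction n with
  | zero => exact MemLp.zero
  | succ n ih =>
    refine (memSobolev_succ_iff hab).2 ⟨⟨0, (LipschitzWith.const 0).lipschitzOnWith⟩,
      fun _ => differentiableOn_const 0, ?_⟩
    simpa using ih

theorem wnorm_zero (hab : a < b) {y : ℝ → E} (h : SameOn a b n y 0) : wnorm a b n y = 0 := by
  rw [h.wnorm_eq]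
  have h0 : wnorm a b 0 (0 : ℝ → E) = 0 :=
    le_antisymm (wnorm_zero_le le_rfl (ae_of_all _ (by simp))) (wnorm_nonneg _)
  clear h
  induction n with
  | zero => exact h0
  | succ n ih =>
    rw [wnorm_succ hab (memSobolev_zero_fun hab), h0, derivWithin_zero, ih, add_zero]

theorem lipschitzOnWith_bilin (L : F →L[ℝ] E →L[ℝ] G) {A : ℝ → F} {y : ℝ → E} {K K' : NNReal}
    (hA : LipschitzOnWith K A (Set.Icc a b)) (hy : LipschitzOnWith K' y (Set.Icc a b)) :
    ∃ K, LipschitzOnWith K (fun t => L (A t) (y t)) (Set.Icc a b) := by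
  obtain ⟨C, hC⟩ := isCompact_Icc.exists_bound_of_continuousOn hA.continuousOn
  obtain ⟨C', hC'⟩ := isCompact_Icc.exists_bound_of_continuousOn hy.continuousOn
  refine ⟨(‖L‖ * C * K' + ‖L‖ * C' * K).toNNReal, LipschitzOnWith.of_dist_le' fun t ht s hs => ?_⟩
  have e : L (A t) (y t) - L (A s) (y s) = L (A t) (y t - y s) + L (A t - A s) (y s) := by
    simp
  have h1 := hA.dist_le_mul t ht s hs
  have h2 := hy.dist_le_mul t ht s hs
  rw [dist_eq_norm] at h1 h2 ⊢
  rw [e]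
  calc _ ≤ ‖L (A t) (y t - y s)‖ + ‖L (A t - A s) (y s)‖ := norm_add_le _ _
    _ ≤ ‖L‖ * ‖A t‖ * ‖y t - y s‖ + ‖L‖ * ‖A t - A s‖ * ‖y s‖ :=
        add_le_add (L.le_opNorm₂ _ _) (L.le_opNorm₂ _ _)
    _ ≤ ‖L‖ * C * (K' * dist t s) + ‖L‖ * (K * dist t s) * C' := by
        have := (norm_nonneg _).trans (hC t ht)
        gcongr
        exacts [hC t ht, hC' s hs]
    _ = _ := by ring

theorem sameOn_derivWithin_bilin (hab : a < b) (L : F →L[ℝ] E →L[ℝ] G) {A : ℝ → F} {y : ℝ → E}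
    (hA : MemSobolev a b (n + 1) ∞ A) (hy : MemSobolev a b (n + 1) ∞ y) :
    SameOn a b n ((fun t => L (A t) (derivWithin y (Set.Icc a b) t)) +
        fun t => L (derivWithin A (Set.Icc a b) t) (y t))
      (derivWithin (fun t => L (A t) (y t)) (Set.Icc a b)) :=
  sameOn_of_differentiable hab hA hy fun t ht h h' =>
    ((L.hasDerivWithinAt_of_bilinear h.hasDerivWithinAt h'.hasDerivWithinAt).derivWithin
      (uniqueDiffOn_Icc hab t ht)).symm

theorem MemSobolev.bilin (hab : a < b) (L : F →L[ℝ] E →L[ℝ] G) {A : ℝ → F} {y : ℝ → E}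
    (hA : MemSobolev a b n ∞ A) (hy : MemSobolev a b n ∞ y) :
    MemSobolev a b n ∞ (fun t => L (A t) (y t)) := by
  induction n generalizing A y with
  | zero =>
    refine memLp_top_of_bound (L.aestronglyMeasurable_comp₂ hA.1 hy.1)
      (‖L‖ * wnorm a b 0 A * wnorm a b 0 y) ?_
    filter_upwards [ae_norm_le_of_memLp hA, ae_norm_le_of_memLp hy] with t h h'
    exact L.le_of_opNorm₂_le_of_le le_rfl h h'
  | succ n ih =>
    obtain ⟨⟨K, h1⟩, h2, h3⟩ := (memSobolev_succ_iff hab).1 hA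
    obtain ⟨⟨K', h1'⟩, h2', h3'⟩ := (memSobolev_succ_iff hab).1 hy
    refine (memSobolev_succ_iff hab).2 ⟨lipschitzOnWith_bilin L h1 h1', fun hn t ht =>
      (L.hasDerivWithinAt_of_bilinear (h2 hn t ht).hasDerivWithinAt
        (h2' hn t ht).hasDerivWithinAt).differentiableWithinAt, ?_⟩
    exact ((ih (hA.of_succ hab) h3').add hab (ih h3 (hy.of_succ hab))).congr hab
      (sameOn_derivWithin_bilin hab L hA hy)

/-- Each use of the product rule produces two products of order `n`, so the constant doubles with
every derivative. -/
theorem wnorm_bilin_le (hab : a < b) (L : F →L[ℝ] E →L[ℝ] G) {A : ℝ → F} {y : ℝ → E}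
    (hA : MemSobolev a b n ∞ A) (hy : MemSobolev a b n ∞ y) :
    wnorm a b n (fun t => L (A t) (y t)) ≤ ‖L‖ * 2 ^ n * (wnorm a b n A * wnorm a b n y) := by
  have h0 {k : ℕ} {A : ℝ → F} {y : ℝ → E} (hA : MemSobolev a b k ∞ A)
      (hy : MemSobolev a b k ∞ y) :
      wnorm a b 0 (fun t => L (A t) (y t)) ≤ ‖L‖ * (wnorm a b 0 A * wnorm a b 0 y) := by
    have h1 := wnorm_nonneg (a := a) (b := b) (n := 0) A
    have h2 := wnorm_nonneg (a := a) (b := b) (n := 0) y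
    refine wnorm_zero_le (by positivity) ?_
    filter_upwards [ae_norm_le_of_memLp hA.memLp, ae_norm_le_of_memLp hy.memLp] with t h h'
    rw [← mul_assoc]
    exact L.le_of_opNorm₂_le_of_le le_rfl h h'
  induction n generalizing A y with
  | zero => simpa using h0 hA hy
  | succ n ih =>
    have hA' := hA.derivWithin hab
    have hy' := hy.derivWithin hab
    have hAn := hA.of_succ hab
    have hyn := hy.of_succ hab
    rw [wnorm_succ hab (hA.bilin hab L hy), ← (sameOn_derivWithin_bilin hab L hA hy).wnorm_eq]
    have h1 := ih hAn hy'
    have h2 := ih hA' hyn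
    have h3 := wnorm_add_le hab (hAn.bilin hab L hy') (hA'.bilin hab L hyn)
    have h4 := h0 hA hy
    have m1 := wnorm_mono hab hA n.le_succ
    have m2 := wnorm_mono hab hy n.le_succ
    have e1 := wnorm_succ hab hA
    have e2 := wnorm_succ hab hy
    have p1 := wnorm_nonneg (a := a) (b := b) (n := 0) A
    have p2 := wnorm_nonneg (a := a) (b := b) (n := 0) y
    have p3 := wnorm_nonneg (a := a) (b := b) (n := n) (derivWithin A (Set.Icc a b))
    have p4 := wnorm_nonneg (a := a) (b := b) (n := n) (derivWithin y (Set.Icc a b))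
    generalize wnorm a b 0 A = A0 at *
    generalize wnorm a b 0 y = y0 at *
    generalize wnorm a b n (derivWithin A (Set.Icc a b)) = A' at *
    generalize wnorm a b n (derivWithin y (Set.Icc a b)) = y' at *
    have hp : (1 : ℝ) ≤ 2 ^ n := one_le_pow₀ one_le_two
    rw [e1] at m1
    rw [e2] at m2
    calc _ ≤ ‖L‖ * (A0 * y0) + (‖L‖ * 2 ^ n * (wnorm a b n A * y') +
          ‖L‖ * 2 ^ n * (A' * wnorm a b n y)) := by linarith
      _ ≤ ‖L‖ * (2 ^ n * A0 * y0) + (‖L‖ * 2 ^ n * ((A0 + A') * y') +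
          ‖L‖ * 2 ^ n * (A' * (y0 + y'))) := by
        gcongr
        exact le_mul_of_one_le_left p1 hp
      _ ≤ ‖L‖ * 2 ^ n * (2 * ((A0 + A') * (y0 + y'))) := by
        refine Eq.trans_le (b := ‖L‖ * 2 ^ n * (A0 * y0 + (A0 + A') * y' + A' * (y0 + y')))
          (by ring) ?_
        gcongr
        -- The right side exceeds the left by `A0 * y0 + A0 * y' + A' * y0`.
        nlinarith [mul_nonneg p1 p2, mul_nonneg p1 p4, mul_nonneg p3 p2]
      _ = _ := by rw [e1, e2]; ring

theorem hasDerivWithinAt_integral {g : ℝ → E} (hg : ContinuousOn g (Set.Icc a b)) (c : E) {t : ℝ}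
    (ht : t ∈ Set.Icc a b) :
    HasDerivWithinAt (fun t => c + ∫ u in a..t, g u) (g t) (Set.Icc a b) t := by
  have := FiniteDimensional.complete ℝ E
  have : Fact (t ∈ Set.Icc a b) := ⟨ht⟩
  refine HasDerivWithinAt.const_add c ?_
  exact intervalIntegral.integral_hasDerivWithinAt_right
    (intervalIntegrable_of_memLp (memLp_of_continuousOn hg) ⟨le_rfl, ht.1.trans ht.2⟩ ht)
    (hg.stronglyMeasurableAtFilter_nhdsWithin measurableSet_Icc t) (hg t ht)

/-- Lebesgue differentiation gives the almost everywhere clause; for `n ≥ 1` the integrand is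
continuous and the classical fundamental theorem applies at every point. -/
theorem sameOn_derivWithin_integral (hab : a < b) {g : ℝ → E} (hg : MemSobolev a b n ∞ g)
    (c : E) : SameOn a b n g (derivWithin (fun t => c + ∫ u in a..t, g u) (Set.Icc a b)) := by
  have := FiniteDimensional.complete ℝ E
  constructor
  · filter_upwards [ae_hasDerivAt_integral hab.le hg.memLp,
      ae_restrict_mem measurableSet_Icc] with t h ht
    exact ((h.const_add c).hasDerivWithinAt.derivWithin (uniqueDiffOn_Icc hab t ht)).symm
  · intro hn t ht
    obtain ⟨k, rfl⟩ := Nat.exists_eq_succ_of_ne_zero hn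
    exact ((hasDerivWithinAt_integral hg.continuousOn c ht).derivWithin
      (uniqueDiffOn_Icc hab t ht)).symm

theorem MemSobolev.integral (hab : a < b) {g : ℝ → E} (hg : MemSobolev a b n ∞ g) (c : E) :
    MemSobolev a b (n + 1) ∞ (fun t => c + ∫ u in a..t, g u) := by
  refine (memSobolev_succ_iff hab).2 ⟨exists_lipschitzOnWith_integral hg.memLp c, fun hn t ht => ?_,
    hg.congr hab (sameOn_derivWithin_integral hab hg c)⟩
  obtain ⟨k, rfl⟩ := Nat.exists_eq_succ_of_ne_zero hn
  exact (hasDerivWithinAt_integral hg.continuousOn c ht).differentiableWithinAt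

/-- The differential expression `y' + A y`, where `A` acts through a bilinear map. -/
noncomputable def lop (a b : ℝ) (L : F →L[ℝ] E →L[ℝ] E) (A : ℝ → F) (y : ℝ → E) : ℝ → E :=
  derivWithin y (Set.Icc a b) + fun t => L (A t) (y t)

theorem MemSobolev.lop (hab : a < b) (L : F →L[ℝ] E →L[ℝ] E) {A : ℝ → F} {y : ℝ → E}
    (hA : MemSobolev a b n ∞ A) (hy : MemSobolev a b (n + 1) ∞ y) :
    MemSobolev a b n ∞ (lop a b L A y) :=
  (hy.derivWithin hab).add hab (hA.bilin hab L (hy.of_succ hab))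

theorem sameOn_lop_add (hab : a < b) (L : F →L[ℝ] E →L[ℝ] E) (A : ℝ → F) {y z : ℝ → E}
    (hy : MemSobolev a b (n + 1) ∞ y) (hz : MemSobolev a b (n + 1) ∞ z) :
    SameOn a b n (lop a b L A (y + z)) (lop a b L A y + lop a b L A z) :=
  sameOn_of_differentiable hab hy hz fun t _ h h' => by
    simp only [MultipointBVP.lop, Pi.add_apply, derivWithin_add h h', map_add]
    abel

theorem sameOn_lop_sub (hab : a < b) (L : F →L[ℝ] E →L[ℝ] E) (A : ℝ → F) {y z : ℝ → E}
    (hy : MemSobolev a b (n + 1) ∞ y) (hz : MemSobolev a b (n + 1) ∞ z) :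
    SameOn a b n (lop a b L A (y - z)) (lop a b L A y - lop a b L A z) :=
  sameOn_of_differentiable hab hy hz fun t _ h h' => by
    simp only [MultipointBVP.lop, Pi.add_apply, Pi.sub_apply, derivWithin_sub h h', map_sub]
    abel

theorem sameOn_lop_smul (hab : a < b) (L : F →L[ℝ] E →L[ℝ] E) (A : ℝ → F) (c : ℝ) {y : ℝ → E}
    (hy : MemSobolev a b (n + 1) ∞ y) :
    SameOn a b n (lop a b L A (c • y)) (c • lop a b L A y) :=
  sameOn_of_differentiable hab hy hy fun t _ h _ => by
    simp only [MultipointBVP.lop, Pi.add_apply, Pi.smul_apply, derivWithin_const_smul c h, map_smul,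
      smul_add]

/-- The derivatives cancel and only the product `(A - A') y` remains, so convergence of coefficients
is convergence of operators in norm. -/
theorem wnorm_lop_sub_lop_le (hab : a < b) (L : F →L[ℝ] E →L[ℝ] E) {A A' : ℝ → F} {y : ℝ → E}
    (hA : MemSobolev a b n ∞ A) (hA' : MemSobolev a b n ∞ A') (hy : MemSobolev a b (n + 1) ∞ y) :
    wnorm a b n (lop a b L A y - lop a b L A' y) ≤
      ‖L‖ * 2 ^ n * (wnorm a b n (A - A') * wnorm a b (n + 1) y) := by
  have e : lop a b L A y - lop a b L A' y = fun t => L ((A - A') t) (y t) := by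
    ext1 t; simp [MultipointBVP.lop]
  rw [e]
  refine (wnorm_bilin_le hab L (hA.sub hab hA') (hy.of_succ hab)).trans ?_
  have := wnorm_nonneg (a := a) (b := b) (n := n) (A - A')
  gcongr
  exact wnorm_mono hab hy n.le_succ

end Algebra

/-! ### The initial value problem: a priori estimate and solvability. -/

section InitialValue

variable {E F : Type*} [NormedAddCommGroup E] [NormedSpace ℝ E] [FiniteDimensional ℝ E]
  [NormedAddCommGroup F] [NormedSpace ℝ F] [FiniteDimensional ℝ F]
variable {a b : ℝ} {n : ℕ}

theorem integral_exp_mul_le {l : ℝ} (hl : 0 < l) (t : ℝ) :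
    ∫ s in a..t, Real.exp (l * s) ≤ Real.exp (l * t) / l := by
  rw [intervalIntegral.integral_comp_mul_left _ hl.ne', integral_exp, smul_eq_mul, inv_mul_eq_div]
  gcongr
  linarith [Real.exp_pos (l * a)]

/-- Gronwall's inequality in integral form. -/
theorem le_of_le_add_integral {φ : ℝ → ℝ} (hφ : ContinuousOn φ (Set.Icc a b))
    (h0 : ∀ t, 0 ≤ φ t) {K M : ℝ} (hM : 0 ≤ M)
    (h : ∀ t ∈ Set.Icc a b, φ t ≤ K + M * ∫ s in a..t, φ s) {t : ℝ} (ht : t ∈ Set.Icc a b) :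
    φ t ≤ 2 * Real.exp ((2 * M + 1) * (b - a)) * K := by
  -- The rate is chosen so that `M / l ≤ 1/2`; the `+ 1` keeps `l` positive when `M = 0`. The proof
  -- maximises `φ` against the weight `exp (-l (t - a))`.
  set l := 2 * M + 1 with hl
  have hlpos : 0 < l := by positivity
  have hw : ContinuousOn (fun t => Real.exp (-(l * (t - a))) * φ t) (Set.Icc a b) :=
    ContinuousOn.mul (by fun_prop) hφ
  obtain ⟨t₀, ht₀, hmax⟩ := isCompact_Icc.exists_isMaxOn ⟨t, ht⟩ hw
  set S := Real.exp (-(l * (t₀ - a))) * φ t₀ with hS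
  have hS0 : 0 ≤ S := mul_nonneg (Real.exp_pos _).le (h0 _)
  have hle : ∀ s ∈ Set.Icc a b, φ s ≤ S * Real.exp (l * (s - a)) := by
    intro s hs
    have h1 : Real.exp (-(l * (s - a))) * φ s ≤ S := hmax hs
    rw [Real.exp_neg, inv_mul_eq_div, div_le_iff₀ (Real.exp_pos _)] at h1
    exact h1
  have hint : ∫ s in a..t₀, φ s ≤ S * (Real.exp (l * (t₀ - a)) / l) := by
    have hsub : Set.uIcc a t₀ ⊆ Set.Icc a b :=
      Set.uIcc_subset_Icc ⟨le_rfl, ht₀.1.trans ht₀.2⟩ ht₀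
    calc ∫ s in a..t₀, φ s ≤ ∫ s in a..t₀, S * Real.exp (l * (s - a)) := by
          refine intervalIntegral.integral_mono_on ht₀.1 (hφ.mono hsub).intervalIntegrable
            (Continuous.intervalIntegrable (by fun_prop) _ _) fun s hs => ?_
          exact hle s ⟨hs.1, hs.2.trans ht₀.2⟩
      _ = S * ∫ s in (a - a)..(t₀ - a), Real.exp (l * s) := by
          rw [intervalIntegral.integral_const_mul,
            intervalIntegral.integral_comp_sub_right (fun s => Real.exp (l * s))]
      _ ≤ _ := by gcongr; exact integral_exp_mul_le hlpos _
  have h1 := h t₀ ht₀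
  have he : 1 ≤ Real.exp (l * (t₀ - a)) :=
    Real.one_le_exp (mul_nonneg hlpos.le (sub_nonneg.2 ht₀.1))
  have h2 : S * Real.exp (l * (t₀ - a)) = φ t₀ := by
    rw [hS, Real.exp_neg]; field_simp
  have h3 : M * (S * (Real.exp (l * (t₀ - a)) / l)) ≤ S * Real.exp (l * (t₀ - a)) / 2 := by
    have : M / l ≤ 1 / 2 := by rw [div_le_div_iff₀ hlpos two_pos]; linarith
    calc _ = (M / l) * (S * Real.exp (l * (t₀ - a))) := by ring
      _ ≤ 1 / 2 * (S * Real.exp (l * (t₀ - a))) := by gcongr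
      _ = _ := by ring
  have h4 := mul_le_mul_of_nonneg_left hint hM
  -- At the maximum point the integral term is at most half of `φ t₀` and is absorbed.
  have h5 : S * Real.exp (l * (t₀ - a)) ≤ 2 * K := by linarith
  have hSK : S ≤ 2 * K := (le_mul_of_one_le_right hS0 he).trans h5
  calc φ t ≤ S * Real.exp (l * (t - a)) := hle t ht
    _ ≤ S * Real.exp (l * (b - a)) := by gcongr; exact ht.2
    _ ≤ 2 * K * Real.exp (l * (b - a)) := by gcongr
    _ = _ := by ring

/-- Writing `y' = (y' + Ay) - Ay` bounds `‖y'‖` almost everywhere by `P + M ‖y‖`; integrating puts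
`‖y‖` in the form required by Gronwall. -/
theorem exists_wnorm_zero_le (hab : a < b) (L : F →L[ℝ] E →L[ℝ] E) {A : ℝ → F}
    (hA : MemSobolev a b n ∞ A) :
    ∃ C, 0 ≤ C ∧ ∀ y : ℝ → E, MemSobolev a b (n + 1) ∞ y →
      wnorm a b 0 y ≤ C * (wnorm a b n (lop a b L A y) + ‖y a‖) := by
  set M := ‖L‖ * wnorm a b 0 A with hM
  have hM0 : 0 ≤ M := mul_nonneg (norm_nonneg L) (wnorm_nonneg A)
  refine ⟨2 * Real.exp ((2 * M + 1) * (b - a)) * (1 + (b - a)), ?_, fun y hy => ?_⟩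
  · have := sub_nonneg.2 hab.le
    positivity
  have hlop := MemSobolev.lop hab L hA hy
  set P := wnorm a b n (lop a b L A y) with hP
  have hP0 : 0 ≤ P := wnorm_nonneg _
  have hae : ∀ᵐ u ∂(volume.restrict (Set.Icc a b)),
      ‖derivWithin y (Set.Icc a b) u‖ ≤ P + M * ‖y u‖ := by
    filter_upwards [ae_norm_le_of_memLp hlop.memLp, ae_norm_le_of_memLp hA.memLp] with u h1 h2
    have e : derivWithin y (Set.Icc a b) u = lop a b L A y u - L (A u) (y u) := by simp [lop]
    rw [e]
    refine (norm_sub_le _ _).trans (add_le_add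
      (h1.trans (wnorm_mono hab hlop (Nat.zero_le _))) ?_)
    exact L.le_of_opNorm₂_le_of_le le_rfl h2 le_rfl
  have hcont := hy.continuousOn
  have hbound : ∀ t ∈ Set.Icc a b, ‖y t‖ ≤ (‖y a‖ + P * (b - a)) + M * ∫ s in a..t, ‖y s‖ := by
    intro t ht
    have hsub : Set.uIcc a t ⊆ Set.Icc a b :=
      Set.uIcc_subset_Icc ⟨le_rfl, ht.1.trans ht.2⟩ ht
    have hi : IntervalIntegrable (fun s => ‖y s‖) volume a t :=
      (hcont.norm.mono hsub).intervalIntegrable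
    have h1 : ‖∫ u in a..t, derivWithin y (Set.Icc a b) u‖ ≤ ∫ u in a..t, (P + M * ‖y u‖) := by
      refine intervalIntegral.norm_integral_le_of_norm_le ht.1 ?_
        (intervalIntegrable_const.add (hi.const_mul M))
      rw [ae_restrict_iff' measurableSet_Icc] at hae
      filter_upwards [hae] with u hu hu'
      exact hu ⟨hu'.1.le, hu'.2.trans ht.2⟩
    rw [intervalIntegral.integral_add intervalIntegrable_const (hi.const_mul M),
      intervalIntegral.integral_const, intervalIntegral.integral_const_mul, smul_eq_mul] at h1
    calc ‖y t‖ = ‖y a + ∫ u in a..t, derivWithin y (Set.Icc a b) u‖ := by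
          rw [← hy.eq_add_integral hab ht]
      _ ≤ ‖y a‖ + ((t - a) * P + M * ∫ s in a..t, ‖y s‖) := (norm_add_le _ _).trans (by gcongr)
      _ ≤ ‖y a‖ + ((b - a) * P + M * ∫ s in a..t, ‖y s‖) := by gcongr; exact ht.2
      _ = _ := by ring
  refine wnorm_zero_le ?_ ?_
  · have := sub_nonneg.2 hab.le
    positivity
  filter_upwards [ae_restrict_mem measurableSet_Icc] with t ht
  refine (le_of_le_add_integral hcont.norm (fun _ => norm_nonneg _) hM0 hbound ht).trans ?_
  rw [mul_assoc _ (1 + (b - a))]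
  gcongr
  nlinarith [norm_nonneg (y a), sub_nonneg.2 hab.le]

/-- A priori estimate for the initial value problem. -/
theorem exists_wnorm_le (hab : a < b) (L : F →L[ℝ] E →L[ℝ] E) {A : ℝ → F}
    (hA : MemSobolev a b n ∞ A) :
    ∃ C, 0 ≤ C ∧ ∀ y : ℝ → E, MemSobolev a b (n + 1) ∞ y →
      wnorm a b (n + 1) y ≤ C * (wnorm a b n (lop a b L A y) + ‖y a‖) := by
  -- Bootstrap on the order: as `y' = (y' + Ay) - Ay`, a bound for `y` in `W^j` bounds `y'` in `W^j`
  -- and hence `y` in `W^{j+1}`. The right-hand side keeps the full order `n` throughout.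
  suffices H : ∀ j ≤ n + 1, ∃ C, 0 ≤ C ∧ ∀ y : ℝ → E, MemSobolev a b (n + 1) ∞ y →
      wnorm a b j y ≤ C * (wnorm a b n (lop a b L A y) + ‖y a‖) from H _ le_rfl
  intro j
  induction j with
  | zero => exact fun _ => exists_wnorm_zero_le hab L hA
  | succ j ih =>
    intro hj
    obtain ⟨C, hC, h⟩ := ih (by omega)
    obtain ⟨C₀, hC₀, h₀⟩ := exists_wnorm_zero_le hab L hA
    have hN := wnorm_nonneg (a := a) (b := b) (n := j) A
    refine ⟨C₀ + 1 + ‖L‖ * 2 ^ j * (wnorm a b j A * C), by positivity, fun y hy => ?_⟩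
    have hlop := MemSobolev.lop hab L hA hy
    have hjn : j ≤ n := by omega
    have hyj := hy.mono hab hj
    have hAj := hA.mono hab hjn
    set R := wnorm a b n (lop a b L A y) + ‖y a‖ with hR
    have e : derivWithin y (Set.Icc a b) = lop a b L A y - fun u => L (A u) (y u) := by
      simp [lop]
    rw [wnorm_succ hab hyj, e]
    have h1 := wnorm_sub_le hab (hlop.mono hab hjn) (hAj.bilin hab L (hyj.of_succ hab))
    have h2 : wnorm a b j (lop a b L A y) ≤ R :=
      (wnorm_mono hab hlop hjn).trans (le_add_of_nonneg_right (norm_nonneg _))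
    have h3 : wnorm a b j (fun t => L (A t) (y t)) ≤ ‖L‖ * 2 ^ j * (wnorm a b j A * (C * R)) := by
      refine (wnorm_bilin_le hab L hAj (hyj.of_succ hab)).trans ?_
      gcongr
      exact h y hy
    calc _ ≤ C₀ * R + (R + ‖L‖ * 2 ^ j * (wnorm a b j A * (C * R))) := by
          linarith [h₀ y hy]
      _ = _ := by ring

/-- A linear Volterra equation with bounded coefficients has a continuous solution. -/
theorem exists_volterra_solution (hab : a < b) (L : F →L[ℝ] E →L[ℝ] E) {A : ℝ → F}
    (hA : MemSobolev a b 0 ∞ A) {h : ℝ → E} (hh : ContinuousOn h (Set.Icc a b)) :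
    ∃ y : ℝ → E, ContinuousOn y (Set.Icc a b) ∧
      ∀ t ∈ Set.Icc a b, y t = h t - ∫ s in a..t, L (A s) (y s) := by
  have := FiniteDimensional.complete ℝ E
  set M := ‖L‖ * wnorm a b 0 A with hM
  have hM0 : 0 ≤ M := mul_nonneg (norm_nonneg L) (wnorm_nonneg A)
  set l := 2 * M + 1 with hl
  have hlpos : 0 < l := by positivity
  -- The unknown is `z = exp (-l t) y`. In the sup norm of `z` the Volterra operator has Lipschitz
  -- constant at most `M / l ≤ 1/2`, so one contraction covers all of `[a,b]`.
  let ext (z : C(Set.Icc a b, E)) (t : ℝ) : E := Real.exp (l * t) • Set.IccExtend hab.le z t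
  have hext (z) : Continuous (ext z) :=
    Continuous.smul (by fun_prop) (z.continuous.Icc_extend' (h := hab.le))
  have hmem (z) : MemLp (fun s => L (A s) (ext z s)) ∞ (volume.restrict (Set.Icc a b)) :=
    MemSobolev.bilin (n := 0) hab L hA (memLp_of_continuousOn (hext z).continuousOn)
  have hV (z) : ContinuousOn (fun t => Real.exp (-(l * t)) • (h t - ∫ s in a..t, L (A s) (ext z s)))
      (Set.Icc a b) := by
    obtain ⟨K, hK⟩ := exists_lipschitzOnWith_integral (hmem z) 0
    have h2 := hK.continuousOn
    simp only [zero_add] at h2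
    exact ContinuousOn.smul (by fun_prop) (hh.sub h2)
  let T (z : C(Set.Icc a b, E)) : C(Set.Icc a b, E) :=
    ⟨(Set.Icc a b).domRestrict
      (fun t => Real.exp (-(l * t)) • (h t - ∫ s in a..t, L (A s) (ext z s))), (hV z).domRestrict⟩
  have hTapp (z) {t : ℝ} (ht : t ∈ Set.Icc a b) :
      T z ⟨t, ht⟩ = Real.exp (-(l * t)) • (h t - ∫ s in a..t, L (A s) (ext z s)) := rfl
  have hT : ContractingWith (1 / 2) T := by
    refine ⟨by norm_num, LipschitzWith.of_dist_le_mul fun z z' => ?_⟩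
    rw [ContinuousMap.dist_le (by positivity)]
    rintro ⟨t, ht⟩
    have ha : a ∈ Set.Icc a b := Set.left_mem_Icc.2 hab.le
    have e : T z ⟨t, ht⟩ - T z' ⟨t, ht⟩ =
        Real.exp (-(l * t)) • ∫ s in a..t, L (A s) (ext z' s - ext z s) := by
      simp only [hTapp, map_sub]
      rw [intervalIntegral.integral_sub (intervalIntegrable_of_memLp (hmem z') ha ht)
        (intervalIntegrable_of_memLp (hmem z) ha ht), ← smul_sub]
      congr 1; abel
    have hbound : ‖∫ s in a..t, L (A s) (ext z' s - ext z s)‖ ≤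
        ∫ s in a..t, M * dist z z' * Real.exp (l * s) := by
      refine intervalIntegral.norm_integral_le_of_norm_le ht.1 ?_
        (Continuous.intervalIntegrable (by fun_prop) _ _)
      have hae := ae_norm_le_of_memLp hA
      rw [ae_restrict_iff' measurableSet_Icc] at hae
      filter_upwards [hae] with s hs hs'
      have hs2 : s ∈ Set.Icc a b := ⟨hs'.1.le, hs'.2.trans ht.2⟩
      rw [mul_assoc]
      refine L.le_of_opNorm₂_le_of_le le_rfl (hs hs2) ?_
      simp only [ext]
      rw [← smul_sub, norm_smul, Real.norm_eq_abs, abs_of_pos (Real.exp_pos _),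
        mul_comm (dist z z')]
      gcongr
      rw [← dist_eq_norm, dist_comm z z']
      exact ContinuousMap.dist_apply_le_dist _
    rw [dist_eq_norm, e, norm_smul, Real.norm_eq_abs, abs_of_pos (Real.exp_pos _)]
    rw [intervalIntegral.integral_const_mul] at hbound
    calc _ ≤ Real.exp (-(l * t)) * (M * dist z z' * (Real.exp (l * t) / l)) := by
          gcongr
          exact hbound.trans (by gcongr; exact integral_exp_mul_le hlpos _)
      _ = (M / l) * dist z z' := by
          rw [Real.exp_neg]; field_simp
      _ ≤ _ := by
          gcongr
          rw [div_le_iff₀ hlpos]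
          push_cast
          linarith
  have : Nonempty C(Set.Icc a b, E) := ⟨0⟩
  obtain hz : T hT.fixedPoint = hT.fixedPoint := hT.fixedPoint_isFixedPt
  set z := hT.fixedPoint
  refine ⟨ext z, (hext z).continuousOn, fun t ht => ?_⟩
  have h1 : z ⟨t, ht⟩ = Real.exp (-(l * t)) • (h t - ∫ s in a..t, L (A s) (ext z s)) := by
    conv_lhs => rw [← hz, hTapp]
  simp only [ext] at h1 ⊢
  rw [Set.IccExtend_of_mem _ _ ht, h1, smul_smul, ← Real.exp_add]
  simp

/-- Solvability of the initial value problem. -/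
theorem exists_initialValue_solution (hab : a < b) (L : F →L[ℝ] E →L[ℝ] E) {A : ℝ → F}
    (hA : MemSobolev a b n ∞ A) {f : ℝ → E} (hf : MemSobolev a b n ∞ f) (c : E) :
    ∃ y : ℝ → E, MemSobolev a b (n + 1) ∞ y ∧
      lop a b L A y =ᵐ[volume.restrict (Set.Icc a b)] f ∧ y a = c := by
  have := FiniteDimensional.complete ℝ E
  obtain ⟨K, hK⟩ := exists_lipschitzOnWith_integral hf.memLp c
  obtain ⟨y, hy, hfix⟩ := exists_volterra_solution hab L (hA.mono hab (Nat.zero_le _))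
    hK.continuousOn
  have ha : a ∈ Set.Icc a b := Set.left_mem_Icc.2 hab.le
  set g : ℝ → E := f - fun s => L (A s) (y s) with hg
  have hfix' : Set.EqOn (fun t => c + ∫ s in a..t, g s) y (Set.Icc a b) := by
    intro t ht
    have hm : MemLp (fun s => L (A s) (y s)) ∞ (volume.restrict (Set.Icc a b)) :=
      MemSobolev.bilin (n := 0) hab L hA.memLp (memLp_of_continuousOn hy)
    simp only [hg, Pi.sub_apply]
    rw [hfix t ht, intervalIntegral.integral_sub (intervalIntegrable_of_memLp hf.memLp ha ht)
      (intervalIntegrable_of_memLp hm ha ht)]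
    abel
  have hgj {j : ℕ} (hj : j ≤ n) (h : MemSobolev a b j ∞ y) : MemSobolev a b j ∞ g :=
    (hf.mono hab hj).sub hab ((hA.mono hab hj).bilin hab L h)
  -- The fixed point is so far only continuous. Each pass gains one order: `y` in `W^j` puts `g = f
  -- - Ay` in `W^j`, and `y` is a primitive of `g`.
  have hreg : ∀ j ≤ n + 1, MemSobolev a b j ∞ y := by
    intro j
    induction j with
    | zero => exact fun _ => memLp_of_continuousOn hy
    | succ j ih =>
      exact fun hj => memSobolev_congr_of_eqOn hab hfix'
        ((hgj (by omega) (ih (by omega))).integral hab c)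
  refine ⟨y, hreg _ le_rfl, ?_, ?_⟩
  · have hs := sameOn_derivWithin_integral hab (hgj le_rfl (hreg n n.le_succ)) c
    filter_upwards [hs.1, ae_restrict_mem measurableSet_Icc] with t h ht
    rw [lop, Pi.add_apply, ← derivWithin_congr hfix' (hfix' ht), ← h]
    simp [hg]
  · rw [← hfix' ha]; simp

end InitialValue

/-! ### Abstract boundary-value problems: Fredholm alternative and perturbation. -/

section BoundaryValue

variable {E F : Type*} [NormedAddCommGroup E] [NormedSpace ℝ E] [FiniteDimensional ℝ E]
  [NormedAddCommGroup F] [NormedSpace ℝ F] [FiniteDimensional ℝ F]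
variable {a b : ℝ} {n : ℕ}

theorem eqOn_zero_of_wnorm_le_zero (hab : a < b) {y : ℝ → E} (hy : MemSobolev a b (n + 1) ∞ y)
    (h : wnorm a b (n + 1) y ≤ 0) : Set.EqOn y 0 (Set.Icc a b) := fun t ht => by
  have := (norm_D_le_wnorm hab hy n.succ_pos ht).trans h
  rw [D_zero] at this
  exact norm_le_zero_iff.1 this

theorem wnorm_lop_eq (hab : a < b) (L : F →L[ℝ] E →L[ℝ] E) {A : ℝ → F} {y f : ℝ → E}
    (hA : MemSobolev a b n ∞ A) (hy : MemSobolev a b (n + 1) ∞ y) (hf : MemSobolev a b n ∞ f)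
    (h : lop a b L A y =ᵐ[volume.restrict (Set.Icc a b)] f) :
    wnorm a b n (lop a b L A y) = wnorm a b n f :=
  (sameOn_of_ae hab (MemSobolev.lop hab L hA hy) hf h).wnorm_eq

/-- The initial value estimate applied to `y - z` has zero right-hand side. -/
theorem eqOn_of_lop_ae_eq (hab : a < b) (L : F →L[ℝ] E →L[ℝ] E) {A : ℝ → F} {y z : ℝ → E}
    (hA : MemSobolev a b n ∞ A) (hy : MemSobolev a b (n + 1) ∞ y)
    (hz : MemSobolev a b (n + 1) ∞ z)
    (h : lop a b L A y =ᵐ[volume.restrict (Set.Icc a b)] lop a b L A z) (h0 : y a = z a) :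
    Set.EqOn y z (Set.Icc a b) := by
  obtain ⟨C, hC, hest⟩ := exists_wnorm_le hab L hA
  have hyz := hy.sub hab hz
  have hl : lop a b L A (y - z) =ᵐ[volume.restrict (Set.Icc a b)] 0 := by
    filter_upwards [(sameOn_lop_sub hab L A hy hz).1, h] with t h1 h2
    rw [h1, Pi.sub_apply, h2, sub_self, Pi.zero_apply]
  have h1 := hest _ hyz
  rw [wnorm_lop_eq hab L hA hyz (memSobolev_zero_fun hab) hl,
    wnorm_zero hab (sameOn_of_eqOn fun _ _ => rfl), Pi.sub_apply, h0, sub_self, norm_zero,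
    add_zero, mul_zero] at h1
  intro t ht
  exact sub_eq_zero.1 (eqOn_zero_of_wnorm_le_zero hab hyz h1 ht)

/-- A boundary operator on `W_∞^n`: it is real linear and depends only on values on `[a,b]`. -/
structure IsBoundary (a b : ℝ) (n : ℕ) (B : (ℝ → E) → E) : Prop where
  add : ∀ y z, MemSobolev a b n ∞ y → MemSobolev a b n ∞ z → B (y + z) = B y + B z
  smul : ∀ (c : ℝ) (y), MemSobolev a b n ∞ y → B (c • y) = c • B y
  congr : ∀ y z, Set.EqOn y z (Set.Icc a b) → B y = B z

theorem IsBoundary.sub {B : (ℝ → E) → E} (hB : IsBoundary a b n B) (hab : a < b) {y z : ℝ → E}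
    (hy : MemSobolev a b n ∞ y) (hz : MemSobolev a b n ∞ z) : B (y - z) = B y - B z := by
  have h1 : y - z = y + (-1 : ℝ) • z := by rw [neg_one_smul, sub_eq_add_neg]
  rw [h1, hB.add _ _ hy (hz.const_smul hab _), hB.smul _ _ hz, neg_one_smul, sub_eq_add_neg]

/-- The characteristic map: initial values of homogeneous solutions to their boundary values. -/
theorem exists_characteristic_map (hab : a < b) (L : F →L[ℝ] E →L[ℝ] E) {A : ℝ → F}
    (hA : MemSobolev a b n ∞ A) {B : (ℝ → E) → E} (hB : IsBoundary a b (n + 1) B) :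
    ∃ (M : E →ₗ[ℝ] E) (Y : E → ℝ → E), ∀ c, MemSobolev a b (n + 1) ∞ (Y c) ∧
      lop a b L A (Y c) =ᵐ[volume.restrict (Set.Icc a b)] 0 ∧ Y c a = c ∧ M c = B (Y c) := by
  choose Y hY hlop ha using
    fun c => exists_initialValue_solution hab L hA (memSobolev_zero_fun hab) c
  refine ⟨{ toFun := fun c => B (Y c), map_add' := fun c d => ?_, map_smul' := fun r c => ?_ }, Y,
    fun c => ⟨hY c, hlop c, ha c, rfl⟩⟩
  · rw [← hB.add _ _ (hY c) (hY d)]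
    -- The chosen solutions are determined only on `[a,b]`; uniqueness there, together with locality
    -- of `B`, makes the map linear.
    refine hB.congr _ _ (eqOn_of_lop_ae_eq hab L hA (hY _) ((hY c).add hab (hY d)) ?_ ?_)
    · filter_upwards [hlop (c + d), hlop c, hlop d, (sameOn_lop_add hab L A (hY c) (hY d)).1] with
        t h1 h2 h3 h4
      rw [h4, Pi.add_apply, h1, h2, h3]; simp
    · rw [Pi.add_apply, ha, ha, ha]
  · rw [RingHom.id_apply, ← hB.smul _ _ (hY c)]
    refine hB.congr _ _ (eqOn_of_lop_ae_eq hab L hA (hY _) ((hY c).const_smul hab r) ?_ ?_)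
    · filter_upwards [hlop (r • c), hlop c, (sameOn_lop_smul hab L A r (hY c)).1] with t h1 h2 h3
      rw [h3, Pi.smul_apply, h1, h2]; simp
    · rw [Pi.smul_apply, ha, ha]

/-- A vector in the kernel is the initial value of a homogeneous solution with zero boundary value,
which vanishes at `a` in particular. -/
theorem characteristic_map_injective (hab : a < b) (L : F →L[ℝ] E →L[ℝ] E) {A : ℝ → F}
    {B : (ℝ → E) → E}
    (huniq : ∀ y, MemSobolev a b (n + 1) ∞ y →
      lop a b L A y =ᵐ[volume.restrict (Set.Icc a b)] 0 → B y = 0 → Set.EqOn y 0 (Set.Icc a b))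
    {M : E →ₗ[ℝ] E} {Y : E → ℝ → E} (h : ∀ c, MemSobolev a b (n + 1) ∞ (Y c) ∧
      lop a b L A (Y c) =ᵐ[volume.restrict (Set.Icc a b)] 0 ∧ Y c a = c ∧ M c = B (Y c)) :
    Function.Injective M := by
  rw [injective_iff_map_eq_zero]
  intro c hc
  obtain ⟨h1, h2, h3, h4⟩ := h c
  have := huniq _ h1 h2 (h4 ▸ hc) (Set.left_mem_Icc.2 hab.le)
  rwa [h3] at this

/-- The Fredholm alternative: uniqueness implies solvability. -/
theorem exists_boundaryValue_solution (hab : a < b) (L : F →L[ℝ] E →L[ℝ] E) {A : ℝ → F}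
    (hA : MemSobolev a b n ∞ A) {B : (ℝ → E) → E} (hB : IsBoundary a b (n + 1) B)
    (huniq : ∀ y, MemSobolev a b (n + 1) ∞ y →
      lop a b L A y =ᵐ[volume.restrict (Set.Icc a b)] 0 → B y = 0 → Set.EqOn y 0 (Set.Icc a b))
    {f : ℝ → E} (hf : MemSobolev a b n ∞ f) (q : E) :
    ∃ y, MemSobolev a b (n + 1) ∞ y ∧
      lop a b L A y =ᵐ[volume.restrict (Set.Icc a b)] f ∧ B y = q := by
  obtain ⟨M, Y, h⟩ := exists_characteristic_map hab L hA hB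
  have hsurj := LinearMap.injective_iff_surjective.1 (characteristic_map_injective hab L huniq h)
  obtain ⟨v, hv, hlv, -⟩ := exists_initialValue_solution hab L hA hf 0
  -- The particular solution `v` has the wrong boundary value; the homogeneous solution with initial
  -- value `c` corrects it.
  obtain ⟨c, hc⟩ := hsurj (q - B v)
  obtain ⟨h1, h2, -, h4⟩ := h c
  refine ⟨v + Y c, hv.add hab h1, ?_, ?_⟩
  · filter_upwards [hlv, h2, (sameOn_lop_add hab L A hv h1).1] with t e1 e2 e3
    rw [e3, Pi.add_apply, e1, e2]; simp
  · rw [hB.add _ _ hv h1, ← h4, hc]; abel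

/-- A priori estimate for a uniquely solvable boundary-value problem. -/
theorem exists_wnorm_le_boundary (hab : a < b) (L : F →L[ℝ] E →L[ℝ] E) {A : ℝ → F}
    (hA : MemSobolev a b n ∞ A) {B : (ℝ → E) → E} (hB : IsBoundary a b (n + 1) B)
    {K : ℝ} (hK : 0 ≤ K)
    (hbdd : ∀ y, MemSobolev a b (n + 1) ∞ y → ‖B y‖ ≤ K * wnorm a b (n + 1) y)
    (huniq : ∀ y, MemSobolev a b (n + 1) ∞ y →
      lop a b L A y =ᵐ[volume.restrict (Set.Icc a b)] 0 → B y = 0 → Set.EqOn y 0 (Set.Icc a b)) :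
    ∃ C, 0 ≤ C ∧ ∀ y, MemSobolev a b (n + 1) ∞ y →
      wnorm a b (n + 1) y ≤ C * (wnorm a b n (lop a b L A y) + ‖B y‖) := by
  obtain ⟨M, Y, h⟩ := exists_characteristic_map hab L hA hB
  have hinj := characteristic_map_injective hab L huniq h
  -- In finite dimension an injective linear map is bounded below.
  obtain ⟨K', -, hanti⟩ := M.exists_antilipschitzWith (LinearMap.ker_eq_bot.2 hinj)
  obtain ⟨C, hC, hest⟩ := exists_wnorm_le hab L hA
  refine ⟨C * (1 + K' * (1 + K * C)), by positivity, fun y hy => ?_⟩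
  have hlop := MemSobolev.lop hab L hA hy
  -- Split `y = v + Y (y a)`: the part `v` carries the right-hand side with zero initial value, so
  -- its norm is at most `C * R`, and `M (y a) = B y - B v` recovers `y a` from the boundary data.
  obtain ⟨v, hv, hlv, hva⟩ := exists_initialValue_solution hab L hA hlop 0
  obtain ⟨h1, h2, h3, h4⟩ := h (y a)
  have heq : Set.EqOn y (v + Y (y a)) (Set.Icc a b) := by
    refine eqOn_of_lop_ae_eq hab L hA hy (hv.add hab h1) ?_ (by rw [Pi.add_apply, hva, h3, zero_add])
    filter_upwards [hlv, h2, (sameOn_lop_add hab L A hv h1).1] with t e1 e2 e3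
    rw [e3, Pi.add_apply, e1, e2]; simp
  have hBy : M (y a) = B y - B v := by
    rw [hB.congr _ _ heq, hB.add _ _ hv h1, h4]; abel
  set R := wnorm a b n (lop a b L A y) with hR
  have hR0 : 0 ≤ R := wnorm_nonneg _
  have hv' : wnorm a b (n + 1) v ≤ C * R := by
    have := hest v hv
    rwa [hva, norm_zero, add_zero, wnorm_lop_eq hab L hA hv hlop hlv] at this
  have hya : ‖y a‖ ≤ K' * (‖B y‖ + K * (C * R)) := by
    have h5 := hanti.le_mul_dist (y a) 0
    rw [dist_zero_right, map_zero, dist_zero_right, hBy] at h5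
    refine h5.trans ?_
    gcongr
    refine (norm_sub_le _ _).trans ?_
    gcongr
    exact (hbdd v hv).trans (by gcongr)
  have hK' : (0 : ℝ) ≤ K' := K'.2
  calc wnorm a b (n + 1) y ≤ C * (R + ‖y a‖) := hest y hy
    _ ≤ C * (R + K' * (‖B y‖ + K * (C * R))) := by gcongr
    _ ≤ C * ((1 + K' * (1 + K * C)) * (R + ‖B y‖)) := by
      gcongr
      have p1 : 0 ≤ K' * R := by positivity
      have p2 : 0 ≤ K' * K * C * ‖B y‖ := by positivity
      nlinarith [norm_nonneg (B y)]
    _ = _ := by ring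

variable {ε₀ : ℝ} {A : ℝ → ℝ → F} {B : ℝ → (ℝ → E) → E} {η : ℝ → ℝ}

/-- The a priori estimate is stable under small perturbations of the problem. -/
theorem exists_uniform_wnorm_le (hab : a < b) (hε₀ : 0 < ε₀) (L : F →L[ℝ] E →L[ℝ] E)
    (hA : ∀ ε ∈ Set.Ico 0 ε₀, MemSobolev a b n ∞ (A ε))
    (hB : ∀ ε ∈ Set.Ico 0 ε₀, IsBoundary a b (n + 1) (B ε))
    {K : ℝ} (hK : 0 ≤ K)
    (hbdd : ∀ y, MemSobolev a b (n + 1) ∞ y → ‖B 0 y‖ ≤ K * wnorm a b (n + 1) y)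
    (hη : Tendsto η (𝓝[>] 0) (𝓝 0))
    (hBη : ∀ ε ∈ Set.Ico 0 ε₀, ∀ y, MemSobolev a b (n + 1) ∞ y →
      ‖B ε y - B 0 y‖ ≤ η ε * wnorm a b (n + 1) y)
    (hA0 : Tendsto (fun ε => wnorm a b n (A ε - A 0)) (𝓝[>] 0) (𝓝 0))
    (huniq : ∀ y, MemSobolev a b (n + 1) ∞ y →
      lop a b L (A 0) y =ᵐ[volume.restrict (Set.Icc a b)] 0 → B 0 y = 0 →
        Set.EqOn y 0 (Set.Icc a b)) :
    ∃ ε₁, 0 < ε₁ ∧ ε₁ < ε₀ ∧ ∃ C, 0 ≤ C ∧ ∀ ε ∈ Set.Ico 0 ε₁, ∀ y, MemSobolev a b (n + 1) ∞ y →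
      wnorm a b (n + 1) y ≤ C * (wnorm a b n (lop a b L (A ε) y) + ‖B ε y‖) := by
  have h0 : (0 : ℝ) ∈ Set.Ico 0 ε₀ := ⟨le_rfl, hε₀⟩
  obtain ⟨C, hC, hest⟩ := exists_wnorm_le_boundary hab L (hA 0 h0) (hB 0 h0) hK hbdd huniq
  have hlim : Tendsto (fun ε => C * (‖L‖ * 2 ^ n * wnorm a b n (A ε - A 0) + η ε))
      (𝓝[>] 0) (𝓝 0) := by
    simpa using ((hA0.const_mul (‖L‖ * 2 ^ n)).add hη).const_mul C
  have hev := hlim.eventually_lt_const (show (0 : ℝ) < 1 / 2 by norm_num)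
  obtain ⟨u, hu, hsub⟩ := (mem_nhdsGT_iff_exists_Ioo_subset (α := ℝ)).1 hev
  -- Halving `ε₀` makes the new bound strictly smaller. The constant `2 * C` results from absorbing
  -- a perturbation of relative size below `1/2`.
  refine ⟨min u (ε₀ / 2), lt_min hu (by linarith), (min_le_right _ _).trans_lt (by linarith),
    2 * C, by positivity, fun ε hε y hy => ?_⟩
  have hε' : ε ∈ Set.Ico 0 ε₀ := ⟨hε.1, hε.2.trans ((min_le_right _ _).trans_lt (by linarith))⟩
  have hpos : 0 ≤ wnorm a b n (lop a b L (A ε) y) + ‖B ε y‖ :=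
    add_nonneg (wnorm_nonneg _) (norm_nonneg _)
  -- The limit along `𝓝[>] 0` says nothing at `ε = 0`, where the unperturbed estimate is used
  -- instead.
  rcases hε.1.eq_or_lt with rfl | hlt
  · refine (hest y hy).trans ?_
    nlinarith [mul_nonneg hC hpos]
  have hsmall : C * (‖L‖ * 2 ^ n * wnorm a b n (A ε - A 0) + η ε) < 1 / 2 :=
    hsub ⟨hlt, hε.2.trans_le (min_le_left _ _)⟩
  have e : lop a b L (A 0) y =
      lop a b L (A ε) y - (lop a b L (A ε) y - lop a b L (A 0) y) := by abel
  have l1 := MemSobolev.lop hab L (hA ε hε') hy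
  have l0 := MemSobolev.lop hab L (hA 0 h0) hy
  have h1 : wnorm a b n (lop a b L (A 0) y) ≤ wnorm a b n (lop a b L (A ε) y) +
      ‖L‖ * 2 ^ n * (wnorm a b n (A ε - A 0) * wnorm a b (n + 1) y) := by
    conv_lhs => rw [e]
    refine (wnorm_sub_le hab l1 (l1.sub hab l0)).trans ?_
    gcongr
    exact wnorm_lop_sub_lop_le hab L (hA ε hε') (hA 0 h0) hy
  have h2 : ‖B 0 y‖ ≤ ‖B ε y‖ + η ε * wnorm a b (n + 1) y := by
    have h3 := hBη ε hε' y hy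
    have h4 := norm_sub_norm_le (B 0 y) (B ε y)
    rw [norm_sub_rev] at h4
    linarith
  have hN := wnorm_nonneg (a := a) (b := b) (n := n + 1) y
  have h3 : wnorm a b (n + 1) y ≤ C * (wnorm a b n (lop a b L (A ε) y) + ‖B ε y‖) +
      C * (‖L‖ * 2 ^ n * wnorm a b n (A ε - A 0) + η ε) * wnorm a b (n + 1) y := by
    refine (hest y hy).trans ?_
    refine (mul_le_mul_of_nonneg_left (add_le_add h1 h2) hC).trans_eq ?_
    ring
  have h4 := mul_le_mul_of_nonneg_right hsmall.le hN
  linarith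

/-- Convergence of the solutions, given a uniform a priori estimate. -/
theorem tendsto_wnorm_sub (hab : a < b) (L : F →L[ℝ] E →L[ℝ] E) {ε₁ C : ℝ} (hε₁ : 0 < ε₁)
    (hA : ∀ ε ∈ Set.Ico 0 ε₁, MemSobolev a b n ∞ (A ε))
    (hB : ∀ ε ∈ Set.Ico 0 ε₁, IsBoundary a b (n + 1) (B ε))
    (hη : Tendsto η (𝓝[>] 0) (𝓝 0))
    (hBη : ∀ ε ∈ Set.Ico 0 ε₁, ∀ y, MemSobolev a b (n + 1) ∞ y →
      ‖B ε y - B 0 y‖ ≤ η ε * wnorm a b (n + 1) y)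
    (hA0 : Tendsto (fun ε => wnorm a b n (A ε - A 0)) (𝓝[>] 0) (𝓝 0)) (hC : 0 ≤ C)
    (hest : ∀ ε ∈ Set.Ico 0 ε₁, ∀ y, MemSobolev a b (n + 1) ∞ y →
      wnorm a b (n + 1) y ≤ C * (wnorm a b n (lop a b L (A ε) y) + ‖B ε y‖))
    {f : ℝ → ℝ → E} {q : ℝ → E} {y : ℝ → ℝ → E}
    (hf : ∀ ε ∈ Set.Ico 0 ε₁, MemSobolev a b n ∞ (f ε))
    (hf0 : Tendsto (fun ε => wnorm a b n (f ε - f 0)) (𝓝[>] 0) (𝓝 0))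
    (hq : Tendsto q (𝓝[>] 0) (𝓝 (q 0)))
    (hy : ∀ ε ∈ Set.Ico 0 ε₁, MemSobolev a b (n + 1) ∞ (y ε) ∧
      lop a b L (A ε) (y ε) =ᵐ[volume.restrict (Set.Icc a b)] f ε ∧ B ε (y ε) = q ε) :
    Tendsto (fun ε => wnorm a b (n + 1) (y ε - y 0)) (𝓝[>] 0) (𝓝 0) := by
  have h0 : (0 : ℝ) ∈ Set.Ico 0 ε₁ := ⟨le_rfl, hε₁⟩
  obtain ⟨hy0, hl0, hb0⟩ := hy 0 h0
  set N := wnorm a b (n + 1) (y 0) with hN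
  have hq' : Tendsto (fun ε => ‖q ε - q 0‖) (𝓝[>] 0) (𝓝 0) :=
    tendsto_iff_norm_sub_tendsto_zero.1 hq
  have hlim : Tendsto (fun ε => C * ((wnorm a b n (f ε - f 0) +
      ‖L‖ * 2 ^ n * (wnorm a b n (A ε - A 0) * N)) + (‖q ε - q 0‖ + η ε * N)))
      (𝓝[>] 0) (𝓝 0) := by
    simpa using ((hf0.add ((hA0.mul_const N).const_mul (‖L‖ * 2 ^ n))).add
      (hq'.add (hη.mul_const N))).const_mul C
  refine squeeze_zero' (Eventually.of_forall fun _ => wnorm_nonneg _) ?_ hlim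
  filter_upwards [Ioo_mem_nhdsGT hε₁] with ε hε
  have hε' : ε ∈ Set.Ico 0 ε₁ := ⟨hε.1.le, hε.2⟩
  obtain ⟨hyε, hlε, hbε⟩ := hy ε hε'
  have hz := hyε.sub hab hy0
  refine (hest ε hε' _ hz).trans ?_
  have m1 := (hf ε hε').sub hab (hf 0 h0)
  have m2 := (MemSobolev.lop hab L (hA ε hε') hy0).sub hab (MemSobolev.lop hab L (hA 0 h0) hy0)
  -- The difference `y ε - y 0` solves the problem at `ε` with data that tend to zero: the change of
  -- `f` minus the operator defect on the fixed function `y 0`. The boundary data are treated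
  -- likewise in `h3`.
  have h1 : lop a b L (A ε) (y ε - y 0) =ᵐ[volume.restrict (Set.Icc a b)]
      ((f ε - f 0) - (lop a b L (A ε) (y 0) - lop a b L (A 0) (y 0))) := by
    filter_upwards [hlε, hl0, (sameOn_lop_sub hab L (A ε) hyε hy0).1] with t e1 e2 e3
    simp only [Pi.sub_apply] at e3 ⊢
    rw [e3, e1, e2]; abel
  have h2 : wnorm a b n (lop a b L (A ε) (y ε - y 0)) ≤ wnorm a b n (f ε - f 0) +
      ‖L‖ * 2 ^ n * (wnorm a b n (A ε - A 0) * N) := by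
    rw [wnorm_lop_eq hab L (hA ε hε') hz (m1.sub hab m2) h1]
    refine (wnorm_sub_le hab m1 m2).trans ?_
    gcongr
    exact wnorm_lop_sub_lop_le hab L (hA ε hε') (hA 0 h0) hy0
  have h3 : ‖B ε (y ε - y 0)‖ ≤ ‖q ε - q 0‖ + η ε * N := by
    have e : B ε (y ε - y 0) = (q ε - q 0) - (B ε (y 0) - B 0 (y 0)) := by
      rw [(hB ε hε').sub hab hyε hy0, hbε, hb0]; abel
    rw [e]
    exact (norm_sub_le _ _).trans (by gcongr; exact hBη ε hε' _ hy0)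
  gcongr

end BoundaryValue

/-! ### Multipoint operators: convergence in operator norm. -/

section Multipoint

variable {m n r : ℕ} {a b : ℝ}

/-- Matrix-vector multiplication as a bounded real bilinear map. -/
noncomputable def mulVecL (m : ℕ) :
    Matrix (Fin m) (Fin m) ℂ →L[ℝ] (Fin m → ℂ) →L[ℝ] (Fin m → ℂ) :=
  LinearMap.mkContinuous₂ (Matrix.mulVecBilin ℝ ℝ) 1 fun A v => by
    rw [one_mul]; exact Matrix.linfty_opNorm_mulVec A v

/-- The end points are null, so the equation on `(a,b)` may be read on `[a,b]`. -/
theorem isSolution_iff {A : ℝ → Matrix (Fin m) (Fin m) ℂ} {B : (ℝ → Fin m → ℂ) → Fin m → ℂ}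
    {f : ℝ → Fin m → ℂ} {q : Fin m → ℂ} {y : ℝ → Fin m → ℂ} :
    IsSolution a b n ∞ A B f q y ↔ MemSobolev a b n ∞ y ∧
      lop a b (mulVecL m) A y =ᵐ[volume.restrict (Set.Icc a b)] f ∧ B y = q := by
  rw [IsSolution, restrict_Ioo_eq_restrict_Icc, D_one]
  rfl

theorem D_add (hab : a < b) {y z : ℝ → Fin m → ℂ} (hy : MemSobolev a b n ∞ y)
    (hz : MemSobolev a b n ∞ z) {l : ℕ} (hl : l < n) {t : ℝ} (ht : t ∈ Set.Icc a b) :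
    D a b l (y + z) t = D a b l y t + D a b l z t :=
  iteratedDerivWithin_add ht (uniqueDiffOn_Icc hab) ((hy.mono hab hl).1 t ht)
    ((hz.mono hab hl).1 t ht)

theorem D_const_smul (c : ℝ) (y : ℝ → Fin m → ℂ) (l : ℕ) (t : ℝ) :
    D a b l (c • y) t = c • D a b l y t := iteratedDerivWithin_const_smul_field c y

variable {ω : ℕ → ℝ → ℕ} {t : ℕ → ℕ → ℝ → ℝ} {τ : ℕ → ℝ}
  {β : ℕ → ℕ → ℕ → ℝ → Matrix (Fin m) (Fin m) ℂ} {βlim : ℕ → ℕ → Matrix (Fin m) (Fin m) ℂ}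
  {ε : ℝ}

theorem isBoundary_multipoint (hab : a < b)
    (ht : ∀ j ≤ r, ∀ k ∈ Finset.Icc 1 (ω j ε), t j k ε ∈ Set.Icc a b) :
    IsBoundary a b n (multipoint a b n r ω t β ε) where
  add y z hy hz := by
    simp only [multipoint, ← Finset.sum_add_distrib]
    refine Finset.sum_congr rfl fun j hj => Finset.sum_congr rfl fun k hk =>
      Finset.sum_congr rfl fun l hl => ?_
    rw [D_add hab hy hz (Finset.mem_range.1 hl) (ht j (Finset.mem_range_succ_iff.1 hj) k hk),
      Matrix.mulVec_add]
  smul c y _ := by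
    simp only [multipoint, Finset.smul_sum, D_const_smul, Matrix.mulVec_smul]
  congr y z h := by
    refine Finset.sum_congr rfl fun j hj => Finset.sum_congr rfl fun k hk =>
      Finset.sum_congr rfl fun l hl => ?_
    rw [D_eqOn h l (ht j (Finset.mem_range_succ_iff.1 hj) k hk)]

theorem norm_limitMultipoint_le (hab : a < b) (hτ : ∀ j ∈ Finset.Icc 1 r, τ j ∈ Set.Icc a b)
    {y : ℝ → Fin m → ℂ} (hy : MemSobolev a b n ∞ y) :
    ‖limitMultipoint a b n r τ βlim y‖ ≤
      (∑ j ∈ Finset.Icc 1 r, ∑ l ∈ Finset.range n, ‖βlim j l‖) * wnorm a b n y := by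
  simp only [limitMultipoint, Finset.sum_mul]
  refine norm_sum_le_of_le _ fun j hj => norm_sum_le_of_le _ fun l hl => ?_
  refine (Matrix.linfty_opNorm_mulVec _ _).trans ?_
  gcongr
  exact norm_D_le_wnorm hab hy (Finset.mem_range.1 hl) (hτ j hj)

/-- The modulus of convergence of the multipoint operators to their limit. -/
noncomputable def modulus (n r : ℕ) (ω : ℕ → ℝ → ℕ) (t : ℕ → ℕ → ℝ → ℝ) (τ : ℕ → ℝ)
    (β : ℕ → ℕ → ℕ → ℝ → Matrix (Fin m) (Fin m) ℂ) (βlim : ℕ → ℕ → Matrix (Fin m) (Fin m) ℂ)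
    (ε : ℝ) : ℝ :=
  (∑ j ∈ Finset.Icc 1 r, ∑ l ∈ Finset.range n,
    (∑ k ∈ Finset.Icc 1 (ω j ε), ‖β j k l ε‖ * |t j k ε - τ j| +
      ‖∑ k ∈ Finset.Icc 1 (ω j ε), β j k l ε - βlim j l‖)) +
    ∑ l ∈ Finset.range n, ∑ k ∈ Finset.Icc 1 (ω 0 ε), ‖β 0 k l ε‖

theorem tendsto_modulus
    (hβ : ∀ j ∈ Finset.Icc 1 r, ∀ l < n,
      Tendsto (fun ε => ∑ k ∈ Finset.Icc 1 (ω j ε), β j k l ε) (𝓝[>] 0) (𝓝 (βlim j l)))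
    (hγ : ∀ j ∈ Finset.Icc 1 r, ∀ l < n,
      Tendsto (fun ε => ∑ k ∈ Finset.Icc 1 (ω j ε), ‖β j k l ε‖ * |t j k ε - τ j|)
        (𝓝[>] 0) (𝓝 0))
    (hδ : ∀ l < n,
      Tendsto (fun ε => ∑ k ∈ Finset.Icc 1 (ω 0 ε), ‖β 0 k l ε‖) (𝓝[>] 0) (𝓝 0)) :
    Tendsto (modulus n r ω t τ β βlim) (𝓝[>] 0) (𝓝 0) := by
  have h1 : Tendsto (fun ε => ∑ j ∈ Finset.Icc 1 r, ∑ l ∈ Finset.range n,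
      (∑ k ∈ Finset.Icc 1 (ω j ε), ‖β j k l ε‖ * |t j k ε - τ j| +
        ‖∑ k ∈ Finset.Icc 1 (ω j ε), β j k l ε - βlim j l‖)) (𝓝[>] 0)
      (𝓝 (∑ j ∈ Finset.Icc 1 r, ∑ l ∈ Finset.range n, (0 + 0 : ℝ))) :=
    tendsto_finsetSum _ fun j hj => tendsto_finsetSum _ fun l hl =>
      (hγ j hj l (Finset.mem_range.1 hl)).add
        (tendsto_iff_norm_sub_tendsto_zero.1 (hβ j hj l (Finset.mem_range.1 hl)))
  have h2 : Tendsto (fun ε => ∑ l ∈ Finset.range n, ∑ k ∈ Finset.Icc 1 (ω 0 ε), ‖β 0 k l ε‖)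
      (𝓝[>] 0) (𝓝 (∑ l ∈ Finset.range n, (0 : ℝ))) :=
    tendsto_finsetSum _ fun l hl => hδ l (Finset.mem_range.1 hl)
  have h := h1.add h2
  simp only [add_zero, Finset.sum_const_zero] at h
  exact h

/-- For `j ≥ 1` replace `y^{(l)}(t_{j,k})` by `y^{(l)}(t_j)`: the increments are controlled by the
Lipschitz bound, and what remains is the error of the summed coefficients at the fixed node. The
group `j = 0` has no limiting node and is bounded outright by the sup norm. -/
theorem norm_multipoint_sub_limitMultipoint_le (hab : a < b)
    (ht : ∀ j ≤ r, ∀ k ∈ Finset.Icc 1 (ω j ε), t j k ε ∈ Set.Icc a b)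
    (hτ : ∀ j ∈ Finset.Icc 1 r, τ j ∈ Set.Icc a b)
    {y : ℝ → Fin m → ℂ} (hy : MemSobolev a b n ∞ y) :
    ‖multipoint a b n r ω t β ε y - limitMultipoint a b n r τ βlim y‖ ≤
      modulus n r ω t τ β βlim ε * wnorm a b n y := by
  have hsplit : multipoint a b n r ω t β ε y - limitMultipoint a b n r τ βlim y =
      (∑ j ∈ Finset.Icc 1 r, ∑ l ∈ Finset.range n,
        (∑ k ∈ Finset.Icc 1 (ω j ε), β j k l ε *ᵥ (D a b l y (t j k ε) - D a b l y (τ j)) +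
          (∑ k ∈ Finset.Icc 1 (ω j ε), β j k l ε - βlim j l) *ᵥ D a b l y (τ j))) +
      ∑ l ∈ Finset.range n, ∑ k ∈ Finset.Icc 1 (ω 0 ε), β 0 k l ε *ᵥ D a b l y (t 0 k ε) := by
    have hr : Finset.range (r + 1) = insert 0 (Finset.Icc 1 r) := by
      ext j; simp only [Finset.mem_range, Finset.mem_insert, Finset.mem_Icc]; omega
    rw [multipoint, limitMultipoint, hr, Finset.sum_insert (by simp), add_comm, add_sub_right_comm,
      ← Finset.sum_sub_distrib, Finset.sum_comm (s := Finset.Icc 1 (ω 0 ε))]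
    congr 1
    refine Finset.sum_congr rfl fun j _ => ?_
    rw [Finset.sum_comm, ← Finset.sum_sub_distrib]
    refine Finset.sum_congr rfl fun l _ => ?_
    simp only [Matrix.mulVec_sub, Matrix.sub_mulVec, Finset.sum_sub_distrib]
    rw [Matrix.sum_mulVec]
    abel
  rw [hsplit, modulus, add_mul]
  refine norm_add_le_of_le ?_ ?_
  · simp only [Finset.sum_mul]
    refine norm_sum_le_of_le _ fun j hj => norm_sum_le_of_le _ fun l hl => ?_
    have hl' := Finset.mem_range.1 hl
    rw [add_mul, Finset.sum_mul]
    refine norm_add_le_of_le (norm_sum_le_of_le _ fun k hk => ?_) ?_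
    · refine (Matrix.linfty_opNorm_mulVec _ _).trans ?_
      rw [mul_assoc, mul_comm |_|]
      gcongr
      exact norm_D_sub_le_wnorm hab hy hl' (hτ j hj) (ht j (Finset.mem_Icc.1 hj).2 k hk)
    · refine (Matrix.linfty_opNorm_mulVec _ _).trans ?_
      gcongr
      exact norm_D_le_wnorm hab hy hl' (hτ j hj)
  · simp only [Finset.sum_mul]
    refine norm_sum_le_of_le _ fun l hl => norm_sum_le_of_le _ fun k hk => ?_
    refine (Matrix.linfty_opNorm_mulVec _ _).trans ?_
    gcongr
    exact norm_D_le_wnorm hab hy (Finset.mem_range.1 hl) (ht 0 (Nat.zero_le _) k hk)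

end Multipoint

/-! ### Passing between extended and real-valued norms. -/

section SobolevConvergence

variable {E : Type*} [NormedAddCommGroup E] [NormedSpace ℝ E] {a b : ℝ} {n : ℕ}

theorem SobolevTendsto.tendsto_wnorm {g : ℝ → ℝ → E} (h : SobolevTendsto a b n ∞ g) :
    Tendsto (fun ε => wnorm a b n (g ε - g 0)) (𝓝[>] 0) (𝓝 0) :=
  (ENNReal.tendsto_toReal ENNReal.zero_ne_top).comp h

/-- Since `toReal` sends `∞` to `0`, real convergence is meaningful only where the norm is finite;
this is why membership is required eventually. -/
theorem sobolevTendsto_of_tendsto_wnorm [FiniteDimensional ℝ E] (hab : a < b) {g : ℝ → ℝ → E}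
    (hg : ∀ᶠ ε in 𝓝[>] 0, MemSobolev a b n ∞ (g ε - g 0))
    (h : Tendsto (fun ε => wnorm a b n (g ε - g 0)) (𝓝[>] 0) (𝓝 0)) :
    SobolevTendsto a b n ∞ g := by
  have h' := ENNReal.tendsto_ofReal h
  rw [ENNReal.ofReal_zero] at h'
  refine h'.congr' ?_
  filter_upwards [hg] with ε hε
  exact ENNReal.ofReal_toReal (hε.sobolevNorm_ne_top hab)

end SobolevConvergence

end MultipointBVP

/-! ### The main theorem. -/

theorem theorem5 {m n r : ℕ} (hn : 1 ≤ n) {a b : ℝ} (hab : a < b)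
    {ε₀ : ℝ} (hε₀ : 0 < ε₀)
    (A : ℝ → ℝ → Matrix (Fin m) (Fin m) ℂ)
    (hA : ∀ ε ∈ Set.Ico 0 ε₀, MultipointBVP.MemSobolev a b (n - 1) ∞ (A ε))
    (ω : ℕ → ℝ → ℕ) (t : ℕ → ℕ → ℝ → ℝ) (τ : ℕ → ℝ)
    (β : ℕ → ℕ → ℕ → ℝ → Matrix (Fin m) (Fin m) ℂ)
    (βlim : ℕ → ℕ → Matrix (Fin m) (Fin m) ℂ)
    (ht : ∀ ε ∈ Set.Ico 0 ε₀, ∀ j ≤ r, ∀ k ∈ Finset.Icc 1 (ω j ε), t j k ε ∈ Set.Icc a b)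
    (hτ : ∀ j ∈ Finset.Icc 1 r, τ j ∈ Set.Icc a b)
    -- at `ε = 0` the boundary condition is the limiting one
    (hB₀ : ∀ y : ℝ → Fin m → ℂ, MultipointBVP.MemSobolev a b n ∞ y →
      MultipointBVP.multipoint a b n r ω t β 0 y =
        MultipointBVP.limitMultipoint a b n r τ βlim y)
    -- (α)
    (hα : ∀ j ∈ Finset.Icc 1 r, ∀ k : ℕ, 1 ≤ k →
      Tendsto (t j k) (𝓝[>] 0 ⊓ 𝓟 {ε | k ≤ ω j ε}) (𝓝 (τ j)))
    -- (β)
    (hβ : ∀ j ∈ Finset.Icc 1 r, ∀ l < n,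
      Tendsto (fun ε => ∑ k ∈ Finset.Icc 1 (ω j ε), β j k l ε) (𝓝[>] 0) (𝓝 (βlim j l)))
    -- (γ)
    (hγ : ∀ j ∈ Finset.Icc 1 r, ∀ l < n,
      Tendsto (fun ε => ∑ k ∈ Finset.Icc 1 (ω j ε), ‖β j k l ε‖ * |t j k ε - τ j|)
        (𝓝[>] 0) (𝓝 0))
    -- (δ)
    (hδ : ∀ l < n,
      Tendsto (fun ε => ∑ k ∈ Finset.Icc 1 (ω 0 ε), ‖β 0 k l ε‖) (𝓝[>] 0) (𝓝 0)) :
    MultipointBVP.StrongTendsto a b n ∞ (MultipointBVP.multipoint a b n r ω t β) ∧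
    (MultipointBVP.OnlyTrivialSolution a b n ∞ (A 0)
        (MultipointBVP.multipoint a b n r ω t β 0) →
      MultipointBVP.SobolevTendsto a b (n - 1) ∞ A →
      MultipointBVP.DependsContinuously a b ε₀ n ∞ A
        (MultipointBVP.multipoint a b n r ω t β)) := by
  -- After this shift solutions lie in `W^{n+1}` and coefficients in `W^n`, as in the abstract
  -- results.
  obtain ⟨n, rfl⟩ := Nat.exists_eq_add_of_le' hn
  simp only [Nat.add_sub_cancel] at hA ⊢
  set B := MultipointBVP.multipoint a b (n + 1) r ω t β
  have hbd : ∀ ε ∈ Set.Ico 0 ε₀, MultipointBVP.IsBoundary a b (n + 1) (B ε) := fun ε hε =>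
    MultipointBVP.isBoundary_multipoint hab (ht ε hε)
  have hη := MultipointBVP.tendsto_modulus hβ hγ hδ
  set η := MultipointBVP.modulus (n + 1) r ω t τ β βlim
  have hBη : ∀ ε ∈ Set.Ico 0 ε₀, ∀ y, MultipointBVP.MemSobolev a b (n + 1) ∞ y →
      ‖B ε y - B 0 y‖ ≤ η ε * MultipointBVP.wnorm a b (n + 1) y := fun ε hε y hy => by
    rw [hB₀ y hy]
    exact MultipointBVP.norm_multipoint_sub_limitMultipoint_le hab (ht ε hε) hτ hy
  constructor
  · intro y hy
    rw [tendsto_iff_norm_sub_tendsto_zero]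
    have hlim : Tendsto (fun ε => η ε * MultipointBVP.wnorm a b (n + 1) y) (𝓝[>] 0) (𝓝 0) := by
      simpa using hη.mul_const (MultipointBVP.wnorm a b (n + 1) y)
    refine squeeze_zero' (Eventually.of_forall fun _ => norm_nonneg _) ?_ hlim
    filter_upwards [Ioo_mem_nhdsGT hε₀] with ε hε using hBη ε ⟨hε.1.le, hε.2⟩ y hy
  intro htriv hAlim
  have hA0 := hAlim.tendsto_wnorm
  have hbdd : ∀ y, MultipointBVP.MemSobolev a b (n + 1) ∞ y → ‖B 0 y‖ ≤
      (∑ j ∈ Finset.Icc 1 r, ∑ l ∈ Finset.range (n + 1), ‖βlim j l‖) *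
        MultipointBVP.wnorm a b (n + 1) y := fun y hy => by
    rw [hB₀ y hy]
    exact MultipointBVP.norm_limitMultipoint_le hab hτ hy
  obtain ⟨ε₁, hε₁, hlt, C, hC, hest⟩ := MultipointBVP.exists_uniform_wnorm_le hab hε₀
    (MultipointBVP.mulVecL m) hA hbd (by positivity) hbdd hη hBη hA0
    fun y hy hl hb => htriv y (MultipointBVP.isSolution_iff.2 ⟨hy, hl, hb⟩)
  have hsub : ∀ ε ∈ Set.Ico 0 ε₁, ε ∈ Set.Ico 0 ε₀ := fun ε hε => ⟨hε.1, hε.2.trans hlt⟩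
  -- With zero data the uniform estimate forces the norm of `y` to vanish, so triviality of the
  -- homogeneous problem spreads from `ε = 0` to all `ε < ε₁`.
  have huniq : ∀ ε ∈ Set.Ico 0 ε₁, ∀ y, MultipointBVP.MemSobolev a b (n + 1) ∞ y →
      MultipointBVP.lop a b (MultipointBVP.mulVecL m) (A ε) y
        =ᵐ[volume.restrict (Set.Icc a b)] 0 → B ε y = 0 → Set.EqOn y 0 (Set.Icc a b) := by
    intro ε hε y hy hl hb
    refine MultipointBVP.eqOn_zero_of_wnorm_le_zero hab hy ((hest ε hε y hy).trans ?_)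
    rw [MultipointBVP.wnorm_lop_eq hab _ (hA ε (hsub ε hε)) hy
      (MultipointBVP.memSobolev_zero_fun hab) hl,
      MultipointBVP.wnorm_zero hab (MultipointBVP.sameOn_of_eqOn fun _ _ => rfl), hb]
    simp
  refine ⟨ε₁, hε₁, hlt, fun ε hε f hf q => ?_, fun f q hf hf0 hq y hy => ?_⟩
  · obtain ⟨y, hy, hl, hb⟩ := MultipointBVP.exists_boundaryValue_solution hab
      (MultipointBVP.mulVecL m) (hA ε (hsub ε hε)) (hbd ε (hsub ε hε)) (huniq ε hε) hf q
    refine ⟨y, MultipointBVP.isSolution_iff.2 ⟨hy, hl, hb⟩, fun z hz => ?_⟩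
    obtain ⟨hz, hlz, hbz⟩ := MultipointBVP.isSolution_iff.1 hz
    have h := huniq ε hε (z - y) (hz.sub hab hy) ?_ ?_
    · exact fun u hu => sub_eq_zero.1 (h hu)
    · filter_upwards [hl, hlz, (MultipointBVP.sameOn_lop_sub hab (MultipointBVP.mulVecL m) (A ε) hz hy).1]
        with u e1 e2 e3
      refine e3.trans ?_
      rw [Pi.sub_apply, e1, e2, sub_self, Pi.zero_apply]
    · rw [(hbd ε (hsub ε hε)).sub hab hz hy, hb, hbz, sub_self]
  · have hy' := fun ε hε => MultipointBVP.isSolution_iff.1 (hy ε hε)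
    refine MultipointBVP.sobolevTendsto_of_tendsto_wnorm hab ?_
      (MultipointBVP.tendsto_wnorm_sub hab (MultipointBVP.mulVecL m) hε₁
        (fun ε hε => hA ε (hsub ε hε)) (fun ε hε => hbd ε (hsub ε hε)) hη
        (fun ε hε => hBη ε (hsub ε hε)) hA0 hC hest (fun ε hε => hf ε (hsub ε hε))
        hf0.tendsto_wnorm hq hy')
    filter_upwards [Ioo_mem_nhdsGT hε₁] with ε hε
    exact (hy' ε ⟨hε.1.le, hε.2⟩).1.sub hab (hy' 0 ⟨le_rfl, hε₁⟩).1
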